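/- Let $f=(f(0),f(1),\dots)$ be a complex time series such that for every $l\in\mathbb N$ the autocovariance $$\rho_l=\lim_{n\to\infty}\frac1n\sum_{k=0}^{n}f(k)\overline{f(k+l)}$$ exists. Let $\tilde{\mathcal H}_f$ be the complex linear span of the shifted series $F_l=(f(l),f(l+1),\dots)$, $l\ge 0$, with the (semi-)inner product $\langle h,g\rangle=\lim_{n\to\infty}\frac1n\sum_{k=0}^{n-1}h_k\overline{g_k}$, let $\mathcal H_f$ be its Hausdorff completion, a Hilbert space, and let $\mathcal K:\mathcal H_f\to\mathcal H_f$ be the isometry that extends $F_l\mapsto F_{l+1}$. Write $f$ also for the element of $\mathcal H_f$ given by $F_0$. Let $\mathcal H_U=\bigcap_{k\ge0}\mathcal K^k\mathcal H_f$ be the unitary part and $\mathcal H_{NU}=\mathcal H_U^\perp$ the completely non-unitary part of $\mathcal H_f$. For $g\in\mathcal H_U$ let $\nu_g$ be its spectral measure, the finite Borel measure on the unit circle $S^1$ with $\int z^k\,d\nu_g=\langle \mathcal K^kg,g\rangle$ for all $k\ge0$; let $\mathcal H_{sc}$ (respectively $\mathcal H_{ac}$) be the set of $g\in\mathcal H_U$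 for which $\nu_g$ is without atoms and singular to Lebesgue measure (respectively absolutely continuous with respect to Lebesgue measure). Then $f$ has a decomposition $$f=\sum_{i}a_iv_i+f_{sc}+f_{ac}+f_{NU},\qquad f_{sc}\in\mathcal H_{sc},\ f_{ac}\in\mathcal H_{ac},\ f_{NU}\in\mathcal H_{NU},$$ where $v_1,v_2,\dots$ is a finite or infinite orthonormal list of eigenvectors of $\mathcal K$ that contains every eigenvector of $\mathcal K$ up to a scalar, and $|a_1|\ge|a_2|\ge\cdots\ge0$ (put $a_i=0$ when $i$ exceeds the number of eigenvectors). Moreover, let $G_{NM}(f)$ be the Gram matrix with entries $$G_{NM,ij}(f)=\frac1M\sum_{t=0}^{M}f(i+t)\overline{f(j+t)},\qquad 0\le i,j\le N,$$ and $d_{NM,1}\ge d_{NM,2}\ge\dots\ge d_{NM,N+1}\ge0$ its eigenvalues with multiplicity. Then for every such decomposition and every $i\ge1$ the iterated limit below exists and $$\lim_{N\to\infty}\lim_{M\to\infty}\frac{d_{NM,i}}{N}=|a_i|^2 .$$ -/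

import Mathlib

open Filter Topology MeasureTheory

noncomputable section

namespace TimeShift

/-! ### Time series with autocovariances -/

/-- The autocovariances `ρ_l = lim_n (1/n) ∑_{k=0}^n f(k) conj f(k+l)` exist for all `l`. -/
def HasAutocovariances (f : ℕ → ℂ) : Prop :=
  ∀ l : ℕ, ∃ ρ : ℂ, Tendsto
    (fun n : ℕ => (1 / (n : ℂ)) * ∑ k ∈ Finset.range (n + 1), f k * starRingEnd ℂ (f (k + l)))
    atTop (𝓝 ρ)

/-- The time average `(1/n) ∑_{k=0}^{n-1} h_k conj g_k`. -/
def timeAverage (h g : ℕ → ℂ) (n : ℕ) : ℂ :=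
  (1 / (n : ℂ)) * ∑ k ∈ Finset.range n, h k * starRingEnd ℂ (g k)

/-- The linear span of the shifted series `F_l = (f(l), f(l+1), …)`. -/
def shiftSpan (f : ℕ → ℂ) : Submodule ℂ (ℕ → ℂ) :=
  Submodule.span ℂ (Set.range fun l : ℕ => fun k : ℕ => f (k + l))

theorem HasAutocovariances.sum_tendsto {f : ℕ → ℂ} (hf : HasAutocovariances f) (l : ℕ) :
    ∃ ρ : ℂ, Tendsto (fun n : ℕ => (1 / (n : ℂ)) *
      ∑ k ∈ Finset.range n, f k * starRingEnd ℂ (f (k + l))) atTop (𝓝 ρ) := by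
  obtain ⟨ρ, hρ⟩ := hf l
  refine ⟨ρ, (tendsto_add_atTop_iff_nat 1).1 ?_⟩
  have h1 : Tendsto (fun n : ℕ => (n : ℂ) / ((n : ℂ) + 1)) atTop (𝓝 1) :=
    tendsto_natCast_div_add_atTop (1 : ℂ)
  have h2 := h1.mul hρ
  rw [one_mul] at h2
  refine h2.congr' ?_
  filter_upwards [eventually_gt_atTop 0] with n hn
  have hn' : (n : ℂ) ≠ 0 := by exact_mod_cast hn.ne'
  have hn1 : (n : ℂ) + 1 ≠ 0 := by exact_mod_cast n.succ_ne_zero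
  push_cast
  field_simp

theorem HasAutocovariances.shift_tendsto {f : ℕ → ℂ} (hf : HasAutocovariances f) (c l : ℕ) :
    ∃ ρ : ℂ, Tendsto
      (timeAverage (fun k => f (k + c)) (fun k => f (k + (c + l)))) atTop (𝓝 ρ) := by
  obtain ⟨ρ, hρ⟩ := hf.sum_tendsto l
  refine ⟨ρ, ?_⟩
  set u : ℕ → ℂ := fun k => f k * starRingEnd ℂ (f (k + l)) with hu
  have hS : ∀ n : ℕ, timeAverage (fun k => f (k + c)) (fun k => f (k + (c + l))) n =
      (((n + c : ℕ) : ℂ) / n) * ((1 / ((n + c : ℕ) : ℂ)) * ∑ k ∈ Finset.range (n + c), u k) -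
        (1 / (n : ℂ)) * ∑ k ∈ Finset.range c, u k := by
    intro n
    rcases Nat.eq_zero_or_pos n with rfl | hn
    · simp [timeAverage]
    have hn' : (n : ℂ) ≠ 0 := by exact_mod_cast hn.ne'
    have hn1 : ((n + c : ℕ) : ℂ) ≠ 0 := by
      have : n + c ≠ 0 := by omega
      exact_mod_cast this
    have hsum : ∑ k ∈ Finset.range (n + c), u k =
        ∑ k ∈ Finset.range c, u k + ∑ k ∈ Finset.range n, u (k + c) := by
      rw [add_comm n c, Finset.sum_range_add]
      simp [add_comm]
    have hterm : ∑ k ∈ Finset.range n, f (k + c) * starRingEnd ℂ (f (k + (c + l))) =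
        ∑ k ∈ Finset.range n, u (k + c) := by
      simp [hu, add_assoc]
    rw [timeAverage, hterm, hsum]
    field_simp
    ring
  have h1 : Tendsto (fun n : ℕ => (1 : ℂ) / (n : ℂ)) atTop (𝓝 0) :=
    tendsto_one_div_atTop_nhds_zero_nat
  have h2 : Tendsto (fun n : ℕ => ((n + c : ℕ) : ℂ) / (n : ℂ)) atTop (𝓝 1) := by
    have h3 : Tendsto (fun n : ℕ => 1 + (c : ℂ) * (1 / (n : ℂ))) atTop (𝓝 (1 + (c : ℂ) * 0)) :=
      tendsto_const_nhds.add (tendsto_const_nhds.mul h1)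
    rw [mul_zero, add_zero] at h3
    refine h3.congr' ?_
    filter_upwards [eventually_gt_atTop 0] with n hn
    have hn' : (n : ℂ) ≠ 0 := by exact_mod_cast hn.ne'
    push_cast
    field_simp
  have h4 := (h2.mul ((tendsto_add_atTop_iff_nat c).2 hρ)).sub
    (h1.mul_const (∑ k ∈ Finset.range c, u k))
  simp only [one_mul, zero_mul, sub_zero] at h4
  exact h4.congr fun n => (hS n).symm

theorem timeAverage_swap (h g : ℕ → ℂ) (n : ℕ) :
    starRingEnd ℂ (timeAverage h g n) = timeAverage g h n := by
  simp [timeAverage, mul_comm]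

theorem timeAverage_add_left (h h' g : ℕ → ℂ) (n : ℕ) :
    timeAverage (h + h') g n = timeAverage h g n + timeAverage h' g n := by
  simp [timeAverage, add_mul, Finset.sum_add_distrib, mul_add]

theorem timeAverage_smul_left (c : ℂ) (h g : ℕ → ℂ) (n : ℕ) :
    timeAverage (c • h) g n = c * timeAverage h g n := by
  simp only [timeAverage, Pi.smul_apply, smul_eq_mul, mul_assoc, ← Finset.mul_sum]
  ring

theorem timeAverage_add_right (h g g' : ℕ → ℂ) (n : ℕ) :
    timeAverage h (g + g') n = timeAverage h g n + timeAverage h g' n := by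
  simp [timeAverage, mul_add, Finset.sum_add_distrib]

theorem timeAverage_smul_right (c : ℂ) (h g : ℕ → ℂ) (n : ℕ) :
    timeAverage h (c • g) n = starRingEnd ℂ c * timeAverage h g n := by
  rw [← timeAverage_swap, timeAverage_smul_left, map_mul, timeAverage_swap]

/-- Time averages of products converge on the span of the shifts. -/
theorem HasAutocovariances.exists_limit {f : ℕ → ℂ} (hf : HasAutocovariances f)
    {h g : ℕ → ℂ} (hh : h ∈ shiftSpan f) (hg : g ∈ shiftSpan f) :
    ∃ ρ : ℂ, Tendsto (timeAverage h g) atTop (𝓝 ρ) := by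
  have zero_left : ∀ g, timeAverage 0 g = fun _ => 0 := by
    intro g; ext n; simp [timeAverage]
  have zero_right : ∀ g, timeAverage g 0 = fun _ => 0 := by
    intro g; ext n; simp [timeAverage]
  induction hh using Submodule.span_induction with
  | mem x hx =>
    obtain ⟨a, rfl⟩ := hx
    induction hg using Submodule.span_induction with
    | mem y hy =>
      obtain ⟨b, rfl⟩ := hy
      rcases le_total a b with hab | hab
      · obtain ⟨l, rfl⟩ := Nat.exists_eq_add_of_le hab
        exact hf.shift_tendsto a l
      · obtain ⟨l, rfl⟩ := Nat.exists_eq_add_of_le hab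
        obtain ⟨ρ, hρ⟩ := hf.shift_tendsto b l
        refine ⟨starRingEnd ℂ ρ, ?_⟩
        have := (Complex.continuous_conj.tendsto ρ).comp hρ
        exact this.congr fun n => timeAverage_swap _ _ n
    | zero => exact ⟨0, by rw [zero_right]; exact tendsto_const_nhds⟩
    | add y z _ _ ihy ihz =>
      obtain ⟨ρ, hρ⟩ := ihy
      obtain ⟨τ, hτ⟩ := ihz
      exact ⟨ρ + τ, (hρ.add hτ).congr fun n => (timeAverage_add_right _ _ _ n).symm⟩
    | smul c y _ ih =>
      obtain ⟨ρ, hρ⟩ := ih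
      exact ⟨starRingEnd ℂ c * ρ,
        (hρ.const_mul _).congr fun n => (timeAverage_smul_right _ _ _ n).symm⟩
  | zero => exact ⟨0, by rw [zero_left]; exact tendsto_const_nhds⟩
  | add y z _ _ ihy ihz =>
    obtain ⟨ρ, hρ⟩ := ihy
    obtain ⟨τ, hτ⟩ := ihz
    exact ⟨ρ + τ, (hρ.add hτ).congr fun n => (timeAverage_add_left _ _ _ n).symm⟩
  | smul c y _ ih =>
    obtain ⟨ρ, hρ⟩ := ih
    exact ⟨c * ρ, (hρ.const_mul _).congr fun n => (timeAverage_smul_left _ _ _ n).symm⟩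

/-! ### The Hilbert space of the series -/

/-- The span of the shifts of `f`, as a type that will carry the semi-inner product given by
time averages. -/
def PreSpace (f : ℕ → ℂ) (_hf : HasAutocovariances f) : Type := shiftSpan f

variable {f : ℕ → ℂ} {hf : HasAutocovariances f}

instance : AddCommGroup (PreSpace f hf) := inferInstanceAs (AddCommGroup (shiftSpan f))

instance : Module ℂ (PreSpace f hf) := inferInstanceAs (Module ℂ (shiftSpan f))

/-- The underlying sequence of an element of the span. -/
def PreSpace.seq (x : PreSpace f hf) : ℕ → ℂ := Subtype.val (p := (· ∈ shiftSpan f)) x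

/-- `⟨h, g⟩ = lim_n (1/n) ∑_{k<n} h_k conj g_k`, linear in `h`. -/
def avgInner (h g : PreSpace f hf) : ℂ := limUnder atTop (timeAverage h.seq g.seq)

theorem avgInner_spec (h g : PreSpace f hf) :
    Tendsto (timeAverage h.seq g.seq) atTop (𝓝 (avgInner h g)) :=
  tendsto_nhds_limUnder (hf.exists_limit h.2 g.2)

/-- In Mathlib's convention the inner product is linear in the second argument, so
`inner x y` is the time average of `y_k conj x_k`. -/
@[reducible]
def preCore : PreInnerProductSpace.Core ℂ (PreSpace f hf) where
  inner x y := avgInner y x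
  conj_inner_symm x y := by
    have h1 := (Complex.continuous_conj.tendsto _).comp (avgInner_spec x y)
    exact tendsto_nhds_unique (h1.congr fun n => timeAverage_swap _ _ n) (avgInner_spec y x)
  re_inner_nonneg x := by
    have h1 := (Complex.continuous_re.tendsto _).comp (avgInner_spec x x)
    refine ge_of_tendsto' h1 fun n => ?_
    have h2 : timeAverage x.seq x.seq n =
        (((1 / (n : ℝ)) * ∑ k ∈ Finset.range n, Complex.normSq (x.seq k) : ℝ) : ℂ) := by
      simp [timeAverage, Complex.mul_conj]
    simp only [Function.comp_apply, h2, Complex.ofReal_re]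
    exact mul_nonneg (by positivity) (Finset.sum_nonneg fun k _ => Complex.normSq_nonneg _)
  add_left x y z := by
    exact tendsto_nhds_unique (avgInner_spec z (x + y))
      (((avgInner_spec z x).add (avgInner_spec z y)).congr fun n =>
        (timeAverage_add_right z.seq x.seq y.seq n).symm)
  smul_left x y r := by
    exact tendsto_nhds_unique (avgInner_spec y (r • x))
      (((avgInner_spec y x).const_mul _).congr fun n =>
        (timeAverage_smul_right r y.seq x.seq n).symm)

instance : SeminormedAddCommGroup (PreSpace f hf) :=
  InnerProductSpace.Core.toSeminormedAddCommGroup (𝕜 := ℂ) (c := preCore)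

instance : InnerProductSpace ℂ (PreSpace f hf) := InnerProductSpace.ofCore preCore

/-- The Hilbert space `H_f`: the (Hausdorff) completion of the span of the shifts of `f`. -/
abbrev HSpace (f : ℕ → ℂ) (hf : HasAutocovariances f) : Type :=
  UniformSpace.Completion (PreSpace f hf)

/-- The series `f` as an element of the span of its shifts. -/
def preObs (f : ℕ → ℂ) (hf : HasAutocovariances f) : PreSpace f hf :=
  ⟨f, Submodule.subset_span ⟨0, rfl⟩⟩

/-- The series `f` as an element of `H_f`. -/
def obs (f : ℕ → ℂ) (hf : HasAutocovariances f) : HSpace f hf := (preObs f hf : HSpace f hf)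

/-! ### The time-shift operator -/

/-- The shift `(h_0, h_1, …) ↦ (h_1, h_2, …)` of sequences; it sends `F_l` to `F_{l+1}`. -/
def seqShift : (ℕ → ℂ) →ₗ[ℂ] (ℕ → ℂ) where
  toFun h k := h (k + 1)
  map_add' _ _ := rfl
  map_smul' _ _ := rfl

theorem seqShift_mem {h : ℕ → ℂ} (hh : h ∈ shiftSpan f) : seqShift h ∈ shiftSpan f := by
  induction hh using Submodule.span_induction with
  | mem x hx =>
    obtain ⟨l, rfl⟩ := hx
    refine Submodule.subset_span ⟨l + 1, ?_⟩
    ext k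
    show f (k + (l + 1)) = f (k + 1 + l)
    congr 1
    omega
  | zero => simp
  | add y z _ _ ihy ihz => rw [map_add]; exact add_mem ihy ihz
  | smul c y _ ih => rw [map_smul]; exact Submodule.smul_mem _ _ ih

/-- The shift on the span of the shifts of `f`. -/
def preShiftₗ (f : ℕ → ℂ) (hf : HasAutocovariances f) : PreSpace f hf →ₗ[ℂ] PreSpace f hf :=
  (seqShift.restrict fun _ hh => seqShift_mem hh : shiftSpan f →ₗ[ℂ] shiftSpan f)

theorem norm_sq_eq_re_avgInner (x : PreSpace f hf) : ‖x‖ ^ 2 = (avgInner x x).re :=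
  InnerProductSpace.norm_sq_eq_re_inner (𝕜 := ℂ) x

theorem norm_preShiftₗ (x : PreSpace f hf) : ‖preShiftₗ f hf x‖ = ‖x‖ := by
  have key : avgInner (preShiftₗ f hf x) (preShiftₗ f hf x) = avgInner x x := by
    refine tendsto_nhds_unique (avgInner_spec _ _) ?_
    have h1 : Tendsto (fun n : ℕ => (1 : ℂ) / (n : ℂ)) atTop (𝓝 0) :=
      tendsto_one_div_atTop_nhds_zero_nat
    have h2 : Tendsto (fun n : ℕ => 1 + (1 : ℂ) / (n : ℂ)) atTop (𝓝 1) := by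
      simpa using h1.const_add (1 : ℂ)
    have h3 := (h2.mul ((tendsto_add_atTop_iff_nat 1).2 (avgInner_spec x x))).sub
      (h1.mul_const (x.seq 0 * starRingEnd ℂ (x.seq 0)))
    simp only [one_mul, zero_mul, sub_zero] at h3
    refine h3.congr' ?_
    filter_upwards [eventually_gt_atTop 0] with n hn
    have hn' : (n : ℂ) ≠ 0 := by exact_mod_cast hn.ne'
    have hn1 : (n : ℂ) + 1 ≠ 0 := by exact_mod_cast n.succ_ne_zero
    have hseq : (preShiftₗ f hf x).seq = fun k => x.seq (k + 1) := rfl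
    rw [hseq, timeAverage, timeAverage, Finset.sum_range_succ']
    push_cast
    field_simp
    ring
  have h := norm_sq_eq_re_avgInner (preShiftₗ f hf x)
  rw [key, ← norm_sq_eq_re_avgInner] at h
  exact (sq_eq_sq₀ (norm_nonneg _) (norm_nonneg _)).1 h

/-- The shift on the span of the shifts of `f`, as an isometry for the time-average seminorm. -/
def preShift (f : ℕ → ℂ) (hf : HasAutocovariances f) : PreSpace f hf →ₗᵢ[ℂ] PreSpace f hf :=
  ⟨preShiftₗ f hf, norm_preShiftₗ⟩

/-- The time-shift operator `K` on `H_f`: the continuous extension of the shift. -/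
def timeShift (f : ℕ → ℂ) (hf : HasAutocovariances f) : HSpace f hf →ₗᵢ[ℂ] HSpace f hf where
  toLinearMap := ((preShift f hf).toContinuousLinearMap.completion : HSpace f hf →ₗ[ℂ] HSpace f hf)
  norm_map' x := by
    induction x using UniformSpace.Completion.induction_on with
    | hp =>
      exact isClosed_eq
        ((preShift f hf).toContinuousLinearMap.completion.continuous.norm) continuous_norm
    | ih x => simp

/-! ### Spectral parts of an isometry -/

/-- The Borel σ-algebra of the unit circle. -/
instance : MeasurableSpace Circle := borel Circle

instance : BorelSpace Circle := ⟨rfl⟩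

section Isometry

variable {E : Type*} [NormedAddCommGroup E] [InnerProductSpace ℂ E]

/-- The unitary part `⋂_k V^k E` of an isometry `V` (Wold decomposition): the largest closed
subspace that `V` maps onto itself. -/
def unitaryPart (V : E →ₗᵢ[ℂ] E) : Submodule ℂ E :=
  ⨅ k : ℕ, LinearMap.range (V ^ k).toLinearMap

/-- The completely non-unitary part: the orthogonal complement of the unitary part. -/
def nonUnitaryPart (V : E →ₗᵢ[ℂ] E) : Submodule ℂ E := (unitaryPart V)ᗮ

/-- `ν` is the spectral measure of the vector `g`: a finite Borel measure on the unit circle with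
`∫ z^k dν = ⟨V^k g, g⟩` for `k ≥ 0` (with Mathlib's `inner`, linear in the second argument). -/
def IsSpectralMeasure (V : E →ₗᵢ[ℂ] E) (g : E) (ν : Measure Circle) : Prop :=
  IsFiniteMeasure ν ∧ ∀ k : ℕ, ∫ z : Circle, (z : ℂ) ^ k ∂ν = inner ℂ g ((V ^ k) g)

/-- Arc length (Lebesgue measure) on the unit circle. -/
def arcLength : Measure Circle :=
  Measure.map Circle.exp (volume.restrict (Set.Ioc (-Real.pi) Real.pi))

/-- The singular continuous subspace: vectors of the unitary part whose spectral measure has no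
atoms and is singular to Lebesgue measure. -/
def singularContinuousPart (V : E →ₗᵢ[ℂ] E) : Set E :=
  {g | g ∈ unitaryPart V ∧
    ∃ ν : Measure Circle, IsSpectralMeasure V g ν ∧ (∀ z : Circle, ν {z} = 0) ∧ ν ⟂ₘ arcLength}

/-- The absolutely continuous subspace: vectors of the unitary part whose spectral measure is
absolutely continuous with respect to Lebesgue measure. -/
def absolutelyContinuousPart (V : E →ₗᵢ[ℂ] E) : Set E :=
  {g | g ∈ unitaryPart V ∧ ∃ ν : Measure Circle, IsSpectralMeasure V g ν ∧ ν ≪ arcLength}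

/-- A decomposition `g = ∑ a_i v_i + g_sc + g_ac + g_NU` with respect to an isometry `V`. The
eigenvectors are `v_i` for `i < n`, where `n` is finite or infinite; the coefficients `a_i` with
`i ≥ n` are zero, and the corresponding `v_i` are meaningless. Indices start at `0`. -/
structure SpectralDecomposition (V : E →ₗᵢ[ℂ] E) (g : E) where
  /-- The number of eigenvectors. -/
  n : ℕ∞
  /-- The eigenvectors of unit length. -/
  v : ℕ → E
  /-- The coefficients. -/
  a : ℕ → ℂ
  /-- The singular continuous component. -/
  gsc : E
  /-- The absolutely continuous component. -/
  gac : E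
  /-- The completely non-unitary component. -/
  gnu : E
  orthonormal : Orthonormal ℂ fun i : {i : ℕ // (i : ℕ∞) < n} => v i
  eigenvector : ∀ i : ℕ, (i : ℕ∞) < n → ∃ ξ : ℂ, V (v i) = ξ • v i
  /-- Every eigenvector occurs in the list, up to a scalar. -/
  complete : ∀ w : E, w ≠ 0 → (∃ ξ : ℂ, V w = ξ • w) → ∃ i : ℕ, (i : ℕ∞) < n ∧ ∃ c : ℂ, w = c • v i
  coeff_eq_zero : ∀ i : ℕ, n ≤ (i : ℕ∞) → a i = 0
  coeff_antitone : Antitone fun i => ‖a i‖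
  gsc_mem : gsc ∈ singularContinuousPart V
  gac_mem : gac ∈ absolutelyContinuousPart V
  gnu_mem : gnu ∈ nonUnitaryPart V
  /-- The sum of the `a_i v_i` converges, and the components add up to `g`. -/
  hasSum : HasSum (fun i => a i • v i) (g - gsc - gac - gnu)

end Isometry

/-! ### Gram matrices -/

/-- The Gram matrix with entries `(1/M) ∑_{t=0}^M f(i+t) conj f(j+t)`, `0 ≤ i, j ≤ N`. -/
def gramMatrix (f : ℕ → ℂ) (N M : ℕ) : Matrix (Fin (N + 1)) (Fin (N + 1)) ℂ :=
  Matrix.of fun i j =>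
    (1 / (M : ℂ)) * ∑ t ∈ Finset.range (M + 1), f (i + t) * starRingEnd ℂ (f (j + t))

theorem gramMatrix_isHermitian (f : ℕ → ℂ) (N M : ℕ) : (gramMatrix f N M).IsHermitian := by
  ext i j
  simp [gramMatrix, Matrix.conjTranspose_apply, mul_comm]

/-- The eigenvalues of the Gram matrix in nonincreasing order with multiplicity, indexed from `0`;
the value is `0` for `i > N`. -/
def gramEigenvalue (f : ℕ → ℂ) (N M i : ℕ) : ℝ :=
  if h : i < N + 1 then
    (gramMatrix_isHermitian f N M).eigenvalues₀ ⟨i, by simpa using h⟩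
  else 0

end TimeShift

end

/-!
For fixed `N`, the limit `M → ∞` turns the Gram matrix of the series into the Gram matrix of the
orbit `f, 𝒦 f, …, 𝒦 ^ N f` in `HSpace`, so the theorem is a statement about an isometry `V` and a
vector `g`. The quadratic form of the orbit Gram matrix is `‖∑ l, conj (c l) • V ^ l g‖ ^ 2`.

The eigenvalues are governed by the point part `∑ i, a i • v i` of `g`. By Wiener's lemma and the
decay of correlations of the remaining parts, their correlations tend to zero in Cesàro mean, and
Schur's test bounds their contribution to the quadratic form by `o(N) * ‖c‖ ^ 2`. The exponential
vectors `(ξ ^ l)` of finitely many eigenvalues `ξ` are asymptotically orthogonal of norm `√N`, so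
on the point part the Gram matrix has approximate eigenvalues `N * ‖a i‖ ^ 2`. The min-max principle
turns both facts into bounds of the sorted eigenvalues.

For existence, the splitting of the unitary part comes from a cyclic representation
`Lp ℂ 2 ν → HSpace` of the continuous functional calculus on the circle, in which `g` is `1`; the
three parts of `g` are the indicator functions of the set of atoms of `ν`, of a Lebesgue-null set
without atoms, and of the rest. As `g` is cyclic, no eigenvector is orthogonal to it, so the
eigenspaces are lines and the nonzero coefficients, being square summable, can be sorted.
-/

noncomputable section

namespace TimeShift

/-! ### The min-max principle -/

section MinMax

variable {𝕜 E : Type*} [RCLike 𝕜] [NormedAddCommGroup E] [InnerProductSpace 𝕜 E]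
  [FiniteDimensional 𝕜 E] {n : ℕ} {T T' : E →ₗ[𝕜] E}

theorem re_inner_apply_self_eq_sum (hT : T.IsSymmetric) (hn : Module.finrank 𝕜 E = n) (x : E) :
    RCLike.re (inner 𝕜 (T x) x) =
      ∑ j, hT.eigenvalues hn j * ‖(hT.eigenvectorBasis hn).repr x j‖ ^ 2 := by
  rw [← (hT.eigenvectorBasis hn).repr.inner_map_map, PiLp.inner_apply, map_sum]
  refine Finset.sum_congr rfl fun j _ => ?_
  rw [hT.eigenvectorBasis_apply_self_apply hn x j, ← smul_eq_mul, inner_smul_left,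
    RCLike.conj_ofReal, RCLike.re_ofReal_mul, inner_self_eq_norm_sq]

theorem finrank_span_eigenvectorBasis_image (hT : T.IsSymmetric) (hn : Module.finrank 𝕜 E = n)
    (s : Finset (Fin n)) :
    Module.finrank 𝕜 (Submodule.span 𝕜 (hT.eigenvectorBasis hn '' s)) = s.card := by
  have hli := ((hT.eigenvectorBasis hn).orthonormal.linearIndependent.comp
    ((↑) : s → Fin n) Subtype.val_injective)
  have := finrank_span_eq_card hli
  rwa [Set.range_comp, Subtype.range_coe_subtype, Fintype.card_coe] at this

theorem eigenvectorBasis_repr_eq_zero_of_mem_span (hT : T.IsSymmetric)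
    (hn : Module.finrank 𝕜 E = n) {s : Set (Fin n)} {x : E}
    (hx : x ∈ Submodule.span 𝕜 (hT.eigenvectorBasis hn '' s)) {j : Fin n} (hj : j ∉ s) :
    (hT.eigenvectorBasis hn).repr x j = 0 := by
  rw [← (hT.eigenvectorBasis hn).coe_toBasis, Module.Basis.mem_span_image] at hx
  simpa using fun h => hj (hx (Finsupp.mem_support_iff.2 h))

theorem exists_finrank_eq_and_eigenvalues_mul_le (hT : T.IsSymmetric)
    (hn : Module.finrank 𝕜 E = n) (i : Fin n) :
    ∃ W : Submodule 𝕜 E, Module.finrank 𝕜 W = i + 1 ∧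
      ∀ x ∈ W, hT.eigenvalues hn i * ‖x‖ ^ 2 ≤ RCLike.re (inner 𝕜 (T x) x) := by
  refine ⟨_, (finrank_span_eigenvectorBasis_image hT hn (Finset.Iic i)).trans (Fin.card_Iic i),
    fun x hx => ?_⟩
  rw [re_inner_apply_self_eq_sum hT hn, ← (hT.eigenvectorBasis hn).repr.norm_map,
    EuclideanSpace.norm_sq_eq, Finset.mul_sum]
  refine Finset.sum_le_sum fun j _ => ?_
  by_cases hj : j ≤ i
  · exact mul_le_mul_of_nonneg_right (hT.eigenvalues_antitone hn hj) (by positivity)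
  · simp [eigenvectorBasis_repr_eq_zero_of_mem_span hT hn hx (by simpa using hj)]

theorem exists_finrank_add_eq_and_le_eigenvalues_mul (hT : T.IsSymmetric)
    (hn : Module.finrank 𝕜 E = n) (i : Fin n) :
    ∃ W : Submodule 𝕜 E, Module.finrank 𝕜 W + i = n ∧
      ∀ x ∈ W, RCLike.re (inner 𝕜 (T x) x) ≤ hT.eigenvalues hn i * ‖x‖ ^ 2 := by
  refine ⟨Submodule.span 𝕜 (hT.eigenvectorBasis hn '' (Finset.Ici i : Finset (Fin n))), ?_,
    fun x hx => ?_⟩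
  · rw [finrank_span_eigenvectorBasis_image, Fin.card_Ici]
    exact Nat.sub_add_cancel i.2.le
  rw [re_inner_apply_self_eq_sum hT hn, ← (hT.eigenvectorBasis hn).repr.norm_map,
    EuclideanSpace.norm_sq_eq, Finset.mul_sum]
  refine Finset.sum_le_sum fun j _ => ?_
  by_cases hj : i ≤ j
  · exact mul_le_mul_of_nonneg_right (hT.eigenvalues_antitone hn hj) (by positivity)
  · simp [eigenvectorBasis_repr_eq_zero_of_mem_span hT hn hx (by simpa using hj)]

theorem exists_mem_mem_ne_zero_of_lt_finrank_add {W W' : Submodule 𝕜 E}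
    (h : Module.finrank 𝕜 E < Module.finrank 𝕜 W + Module.finrank 𝕜 W') :
    ∃ x ∈ W, x ∈ W' ∧ x ≠ 0 := by
  have hdisj : ¬ Disjoint W W' := fun hd =>
    h.not_ge (Submodule.finrank_add_finrank_le_of_disjoint hd)
  obtain ⟨x, hx, hx0⟩ := Submodule.exists_mem_ne_zero_of_ne_bot (mt disjoint_iff.2 hdisj)
  exact ⟨x, hx.1, hx.2, hx0⟩

theorem le_eigenvalues_of_lt_finrank (hT : T.IsSymmetric) (hn : Module.finrank 𝕜 E = n)
    {i : Fin n} {W : Submodule 𝕜 E} (hW : (i : ℕ) < Module.finrank 𝕜 W) {c : ℝ}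
    (h : ∀ x ∈ W, c * ‖x‖ ^ 2 ≤ RCLike.re (inner 𝕜 (T x) x)) :
    c ≤ hT.eigenvalues hn i := by
  obtain ⟨W', hW', hle⟩ := exists_finrank_add_eq_and_le_eigenvalues_mul hT hn i
  obtain ⟨x, hx, hx', hx0⟩ := exists_mem_mem_ne_zero_of_lt_finrank_add (W := W) (W' := W')
    (by omega)
  exact le_of_mul_le_mul_right ((h x hx).trans (hle x hx')) (by positivity)

theorem eigenvalues_le_of_le_finrank_add (hT : T.IsSymmetric) (hn : Module.finrank 𝕜 E = n)
    {i : Fin n} {W : Submodule 𝕜 E} (hW : n ≤ Module.finrank 𝕜 W + i) {c : ℝ}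
    (h : ∀ x ∈ W, RCLike.re (inner 𝕜 (T x) x) ≤ c * ‖x‖ ^ 2) :
    hT.eigenvalues hn i ≤ c := by
  obtain ⟨W', hW', hle⟩ := exists_finrank_eq_and_eigenvalues_mul_le hT hn i
  obtain ⟨x, hx, hx', hx0⟩ := exists_mem_mem_ne_zero_of_lt_finrank_add (W := W) (W' := W')
    (by omega)
  exact le_of_mul_le_mul_right ((hle x hx').trans (h x hx)) (by positivity)

theorem eigenvalues_le_add_of_re_inner_le (hT : T.IsSymmetric) (hT' : T'.IsSymmetric)
    (hn : Module.finrank 𝕜 E = n) (i : Fin n) {ε : ℝ}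
    (h : ∀ x, RCLike.re (inner 𝕜 (T x) x) ≤ RCLike.re (inner 𝕜 (T' x) x) + ε * ‖x‖ ^ 2) :
    hT.eigenvalues hn i ≤ hT'.eigenvalues hn i + ε := by
  obtain ⟨W, hW, hle⟩ := exists_finrank_add_eq_and_le_eigenvalues_mul hT' hn i
  refine eigenvalues_le_of_le_finrank_add hT hn hW.ge fun x hx => (h x).trans ?_
  rw [add_mul]
  gcongr
  exact hle x hx

theorem abs_eigenvalues_sub_le (hT : T.IsSymmetric) (hT' : T'.IsSymmetric)
    (hn : Module.finrank 𝕜 E = n) (i : Fin n) {ε : ℝ}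
    (h : ∀ x, ‖T x - T' x‖ ≤ ε * ‖x‖) :
    |hT.eigenvalues hn i - hT'.eigenvalues hn i| ≤ ε := by
  have hform (x : E) :
      |RCLike.re (inner 𝕜 (T x) x) - RCLike.re (inner 𝕜 (T' x) x)| ≤ ε * ‖x‖ ^ 2 := by
    rw [← map_sub, ← inner_sub_left, sq, ← mul_assoc]
    exact (RCLike.abs_re_le_norm _).trans ((norm_inner_le_norm _ _).trans
      (mul_le_mul_of_nonneg_right (h x) (norm_nonneg x)))
  rw [abs_sub_le_iff, sub_le_iff_le_add', sub_le_iff_le_add']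
  exact ⟨eigenvalues_le_add_of_re_inner_le hT hT' hn i fun x => by
      linarith [le_of_abs_le (hform x)],
    eigenvalues_le_add_of_re_inner_le hT' hT hn i fun x => by
      linarith [neg_le_of_abs_le (hform x)]⟩

theorem tendsto_eigenvalues₀ {ι α : Type*} [Fintype ι] [DecidableEq ι] {l : Filter α}
    {A : α → Matrix ι ι 𝕜} {B : Matrix ι ι 𝕜} (hA : ∀ t, (A t).IsHermitian) (hB : B.IsHermitian)
    (h : Tendsto A l (𝓝 B)) (i : Fin (Fintype.card ι)) :
    Tendsto (fun t => (hA t).eigenvalues₀ i) l (𝓝 (hB.eigenvalues₀ i)) := by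
  let Φ := (Matrix.toEuclideanCLM (n := ι) (𝕜 := 𝕜)).toAlgEquiv.toLinearMap
  have hΦ : Tendsto (fun t => ‖Φ (A t - B)‖) l (𝓝 0) := by
    have := (Φ.continuous_of_finiteDimensional.tendsto _).comp (h.sub_const B)
    simpa using this.norm
  refine tendsto_iff_dist_tendsto_zero.2 (squeeze_zero (fun _ => dist_nonneg) (fun t => ?_) hΦ)
  refine abs_eigenvalues_sub_le _ _ _ _ fun x => ?_
  rw [← LinearMap.sub_apply, ← map_sub]
  exact (Φ (A t - B)).le_opNorm x

end MinMax

/-! ### Schur's test and Riesz bounds -/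

theorem sum_sum_mul_mul_le {ι : Type*} [Fintype ι] {K : ι → ι → ℝ} (hK : ∀ i j, 0 ≤ K i j)
    (hsymm : ∀ i j, K i j = K j i) {S : ℝ} (hS : ∀ i, ∑ j, K i j ≤ S) (s : ι → ℝ) :
    ∑ i, ∑ j, s i * s j * K i j ≤ S * ∑ i, s i ^ 2 := by
  have hrow : ∑ i, ∑ j, s i ^ 2 * K i j ≤ S * ∑ i, s i ^ 2 := by
    simp only [← Finset.mul_sum]
    rw [Finset.mul_sum]
    refine Finset.sum_le_sum fun i _ => ?_
    rw [mul_comm S]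
    exact mul_le_mul_of_nonneg_left (hS i) (sq_nonneg _)
  have hcol : ∑ i, ∑ j, s j ^ 2 * K i j = ∑ i, ∑ j, s i ^ 2 * K i j := by
    rw [Finset.sum_comm]
    simp only [hsymm]
  calc ∑ i, ∑ j, s i * s j * K i j
      ≤ ∑ i, ∑ j, (s i ^ 2 * K i j + s j ^ 2 * K i j) / 2 := by
        gcongr with i _ j _
        nlinarith [mul_nonneg (sq_nonneg (s i - s j)) (hK i j)]
    _ = (∑ i, ∑ j, s i ^ 2 * K i j + ∑ i, ∑ j, s j ^ 2 * K i j) / 2 := by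
        simp only [← Finset.sum_div, Finset.sum_add_distrib]
    _ ≤ S * ∑ i, s i ^ 2 := by linarith

section RieszBounds

variable {𝕜 E ι : Type*} [RCLike 𝕜] [NormedAddCommGroup E] [InnerProductSpace 𝕜 E] [Fintype ι]
  {x : ι → E}

theorem abs_norm_sum_smul_sq_sub_le [DecidableEq ι] {D S : ℝ}
    (h : ∀ i, ∑ j, ‖inner 𝕜 (x i) (x j) - if i = j then (D : 𝕜) else 0‖ ≤ S) (s : ι → 𝕜) :
    |‖∑ i, s i • x i‖ ^ 2 - D * ∑ i, ‖s i‖ ^ 2| ≤ S * ∑ i, ‖s i‖ ^ 2 := by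
  let K (i j : ι) : 𝕜 := inner 𝕜 (x i) (x j) - if i = j then (D : 𝕜) else 0
  have hexpand : ((‖∑ i, s i • x i‖ ^ 2 - D * ∑ i, ‖s i‖ ^ 2 : ℝ) : 𝕜) =
      ∑ i, ∑ j, starRingEnd 𝕜 (s i) * s j * K i j := by
    simp only [K, mul_sub, Finset.sum_sub_distrib, mul_ite, mul_zero, Finset.sum_ite_eq,
      Finset.mem_univ, if_true, RCLike.conj_mul, ← Finset.sum_mul]
    push_cast
    rw [← inner_self_eq_norm_sq_to_K, sum_inner, mul_comm (D : 𝕜)]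
    simp only [inner_sum, inner_smul_left, inner_smul_right, mul_assoc, mul_left_comm]
  have hsymm (i j : ι) : ‖K i j‖ = ‖K j i‖ := by
    rw [← RCLike.norm_conj (K i j)]
    simp only [K, map_sub, inner_conj_symm, apply_ite (starRingEnd 𝕜), RCLike.conj_ofReal,
      map_zero, eq_comm]
  calc |‖∑ i, s i • x i‖ ^ 2 - D * ∑ i, ‖s i‖ ^ 2|
      = ‖∑ i, ∑ j, starRingEnd 𝕜 (s i) * s j * K i j‖ := by
        rw [← hexpand, RCLike.norm_ofReal]
    _ ≤ ∑ i, ∑ j, ‖starRingEnd 𝕜 (s i) * s j * K i j‖ :=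
        (norm_sum_le _ _).trans (Finset.sum_le_sum fun i _ => norm_sum_le _ _)
    _ = ∑ i, ∑ j, ‖s i‖ * ‖s j‖ * ‖K i j‖ := by simp only [norm_mul, RCLike.norm_conj]
    _ ≤ S * ∑ i, ‖s i‖ ^ 2 := sum_sum_mul_mul_le (fun _ _ => norm_nonneg _) hsymm h _

theorem norm_sum_smul_sq_le {S : ℝ} (h : ∀ i, ∑ j, ‖inner 𝕜 (x i) (x j)‖ ≤ S) (s : ι → 𝕜) :
    ‖∑ i, s i • x i‖ ^ 2 ≤ S * ∑ i, ‖s i‖ ^ 2 := by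
  classical
  have := abs_norm_sum_smul_sq_sub_le (D := 0) (x := x) (by simpa using h) s
  rw [zero_mul, sub_zero] at this
  exact le_of_abs_le this

theorem sum_norm_inner_sq_le {B : ℝ} (hB : 0 ≤ B)
    (h : ∀ s : ι → 𝕜, ‖∑ i, s i • x i‖ ^ 2 ≤ B * ∑ i, ‖s i‖ ^ 2) (c : E) :
    ∑ i, ‖inner 𝕜 (x i) c‖ ^ 2 ≤ B * ‖c‖ ^ 2 := by
  let y := ∑ i, inner 𝕜 (x i) c • x i
  let Q := ∑ i, ‖inner 𝕜 (x i) c‖ ^ 2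
  change Q ≤ B * ‖c‖ ^ 2
  have hQ : Q ≤ ‖y‖ * ‖c‖ := by
    have hyc : inner 𝕜 y c = (Q : 𝕜) := by
      simp only [y, Q, sum_inner, inner_smul_left, RCLike.conj_mul, RCLike.ofReal_sum,
        RCLike.ofReal_pow]
    have := norm_inner_le_norm (𝕜 := 𝕜) y c
    rw [hyc, RCLike.norm_ofReal] at this
    exact (le_abs_self Q).trans this
  have hy : ‖y‖ ^ 2 ≤ B * Q := h _
  rcases (by positivity : 0 ≤ Q).eq_or_lt with hQ0 | hQ0
  · rw [← hQ0]
    positivity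
  · refine le_of_mul_le_mul_left ?_ hQ0
    calc Q * Q ≤ (‖y‖ * ‖c‖) * (‖y‖ * ‖c‖) := by gcongr
      _ = ‖y‖ ^ 2 * ‖c‖ ^ 2 := by ring
      _ ≤ B * Q * ‖c‖ ^ 2 := by gcongr
      _ = Q * (B * ‖c‖ ^ 2) := by ring

theorem mul_norm_sq_le_sum_norm_inner_sq {A : ℝ} (hA : 0 ≤ A)
    (h : ∀ s : ι → 𝕜, A * ∑ i, ‖s i‖ ^ 2 ≤ ‖∑ i, s i • x i‖ ^ 2) {c : E}
    (hc : c ∈ Submodule.span 𝕜 (Set.range x)) :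
    A * ‖c‖ ^ 2 ≤ ∑ i, ‖inner 𝕜 (x i) c‖ ^ 2 := by
  obtain ⟨s, hs⟩ := (Submodule.mem_span_range_iff_exists_fun 𝕜).1 hc
  have hcc : ‖c‖ ^ 2 ≤ ∑ i, ‖s i‖ * ‖inner 𝕜 (x i) c‖ := by
    calc ‖c‖ ^ 2 = ‖inner 𝕜 c c‖ := by simp [inner_self_eq_norm_sq_to_K]
      _ = ‖∑ i, starRingEnd 𝕜 (s i) * inner 𝕜 (x i) c‖ := by
          nth_rw 1 [← hs]
          simp only [sum_inner, inner_smul_left]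
      _ ≤ ∑ i, ‖starRingEnd 𝕜 (s i) * inner 𝕜 (x i) c‖ := norm_sum_le _ _
      _ = ∑ i, ‖s i‖ * ‖inner 𝕜 (x i) c‖ := by simp only [norm_mul, RCLike.norm_conj]
  rcases (sq_nonneg ‖c‖).eq_or_lt with hc0 | hc0
  · rw [← hc0, mul_zero]
    positivity
  · refine le_of_mul_le_mul_left ?_ hc0
    calc ‖c‖ ^ 2 * (A * ‖c‖ ^ 2) = A * (‖c‖ ^ 2) ^ 2 := by ring
      _ ≤ A * ((∑ i, ‖s i‖ ^ 2) * ∑ i, ‖inner 𝕜 (x i) c‖ ^ 2) := by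
          gcongr
          exact (pow_le_pow_left₀ hc0.le hcc 2).trans (Finset.sum_mul_sq_le_sq_mul_sq _ _ _)
      _ = (A * ∑ i, ‖s i‖ ^ 2) * ∑ i, ‖inner 𝕜 (x i) c‖ ^ 2 := by ring
      _ ≤ ‖c‖ ^ 2 * ∑ i, ‖inner 𝕜 (x i) c‖ ^ 2 := by
          gcongr
          exact hs ▸ h s

theorem linearIndependent_of_mul_sum_sq_le {A : ℝ} (hA : 0 < A)
    (h : ∀ s : ι → 𝕜, A * ∑ i, ‖s i‖ ^ 2 ≤ ‖∑ i, s i • x i‖ ^ 2) : LinearIndependent 𝕜 x := by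
  refine Fintype.linearIndependent_iff.2 fun s hs i => ?_
  have hsum : ∑ i, ‖s i‖ ^ 2 = 0 := by
    refine le_antisymm (nonpos_of_mul_nonpos_right ((h s).trans ?_) hA) (by positivity)
    simp [hs]
  have := (Finset.sum_eq_zero_iff_of_nonneg fun _ _ => sq_nonneg _).1 hsum i (Finset.mem_univ i)
  simpa using this

end RieszBounds

/-! ### Exponential vectors -/

theorem norm_geom_sum_le {q : ℂ} (hq : ‖q‖ ≤ 1) (hq1 : q ≠ 1) (N : ℕ) :
    ‖∑ l ∈ Finset.range N, q ^ l‖ ≤ 2 / ‖q - 1‖ := by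
  rw [geom_sum_eq hq1, norm_div]
  gcongr
  calc ‖q ^ N - 1‖ ≤ ‖q‖ ^ N + 1 := by simpa using norm_sub_le (q ^ N) 1
    _ ≤ 2 := by linarith [pow_le_one₀ (n := N) (norm_nonneg q) hq]

theorem tendsto_average_pow {q : ℂ} (hq : ‖q‖ ≤ 1) :
    Tendsto (fun N : ℕ => (N : ℂ)⁻¹ * ∑ l ∈ Finset.range N, q ^ l) atTop
      (𝓝 (if q = 1 then 1 else 0)) := by
  split_ifs with h
  · refine tendsto_const_nhds.congr' ?_
    filter_upwards [eventually_ne_atTop 0] with N hN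
    simp [h, hN]
  · have hlim := tendsto_inv_atTop_nhds_zero_nat (𝕜 := ℝ)
    refine squeeze_zero_norm (fun N => ?_) (by simpa using hlim.mul_const (2 / ‖q - 1‖))
    rw [norm_mul, norm_inv, Complex.norm_natCast]
    gcongr
    exact norm_geom_sum_le hq h N

theorem mul_conj_eq_one_iff {ξ ζ : ℂ} (hξ : ‖ξ‖ = 1) : ζ * starRingEnd ℂ ξ = 1 ↔ ξ = ζ := by
  have hξ0 : ξ ≠ 0 := norm_ne_zero_iff.1 (by simp [hξ])
  rw [← Complex.inv_eq_conj hξ, mul_inv_eq_one₀ hξ0, eq_comm]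

/-- The vector `(1, ξ, …, ξ ^ (N - 1))`; for a unimodular eigenvalue `ξ` of an isometry it is
an approximate eigenvector of the Gram matrices of orbits. -/
def expVec (ξ : ℂ) (N : ℕ) : EuclideanSpace ℂ (Fin N) := WithLp.toLp 2 fun l => ξ ^ (l : ℕ)

theorem norm_expVec {ξ : ℂ} (hξ : ‖ξ‖ = 1) (N : ℕ) : ‖expVec ξ N‖ = √N := by
  simp [EuclideanSpace.norm_eq, expVec, hξ]

theorem inner_expVec (ξ ζ : ℂ) (N : ℕ) :
    inner ℂ (expVec ξ N) (expVec ζ N) = ∑ l ∈ Finset.range N, (ζ * starRingEnd ℂ ξ) ^ l := by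
  rw [PiLp.inner_apply, ← Fin.sum_univ_eq_sum_range (fun l => (ζ * starRingEnd ℂ ξ) ^ l)]
  simp [expVec, mul_pow]

theorem eventually_abs_norm_sum_smul_expVec_sq_sub_le {ι : Type*} [Fintype ι] {ξ : ι → ℂ}
    (hinj : Function.Injective ξ) (hξ : ∀ j, ‖ξ j‖ = 1) {δ : ℝ} (hδ : 0 < δ) :
    ∀ᶠ N : ℕ in atTop, ∀ s : ι → ℂ,
      |‖∑ j, s j • expVec (ξ j) N‖ ^ 2 - N * ∑ j, ‖s j‖ ^ 2| ≤ δ * N * ∑ j, ‖s j‖ ^ 2 := by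
  classical
  have hentry (i j : ι) : Tendsto (fun N : ℕ => ‖(N : ℂ)⁻¹ *
      inner ℂ (expVec (ξ i) N) (expVec (ξ j) N) - if i = j then 1 else 0‖) atTop (𝓝 0) := by
    have hq : ‖ξ j * starRingEnd ℂ (ξ i)‖ ≤ 1 := by simp [hξ]
    have := ((tendsto_average_pow hq).sub_const (if i = j then 1 else 0)).norm
    simpa only [inner_expVec, mul_conj_eq_one_iff (hξ i), hinj.eq_iff, sub_self, norm_zero]
      using this
  have hrow (i : ι) : ∀ᶠ N : ℕ in atTop, ∑ j, ‖(N : ℂ)⁻¹ *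
      inner ℂ (expVec (ξ i) N) (expVec (ξ j) N) - if i = j then 1 else 0‖ < δ := by
    have := tendsto_finsetSum Finset.univ fun j _ => hentry i j
    rw [Finset.sum_const_zero] at this
    exact this.eventually_lt_const hδ
  filter_upwards [eventually_all.2 hrow, eventually_ne_atTop 0] with N hN hN0
  refine abs_norm_sum_smul_sq_sub_le (fun i => ?_)
  have hNC : (N : ℂ) ≠ 0 := Nat.cast_ne_zero.2 hN0
  calc ∑ j, ‖inner ℂ (expVec (ξ i) N) (expVec (ξ j) N) - if i = j then ((N : ℝ) : ℂ) else 0‖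
      = (∑ j, ‖(N : ℂ)⁻¹ * inner ℂ (expVec (ξ i) N) (expVec (ξ j) N) -
          if i = j then 1 else 0‖) * N := by
        rw [Finset.sum_mul]
        refine Finset.sum_congr rfl fun j _ => ?_
        have hN (z : ℂ) : ‖z‖ * N = ‖z * (N : ℂ)‖ := by rw [norm_mul, Complex.norm_natCast]
        rw [hN, sub_mul, mul_right_comm, inv_mul_cancel₀ hNC, one_mul, ite_mul, one_mul, zero_mul,
          Complex.ofReal_natCast]
    _ ≤ δ * N := by gcongr; exact (hN i).le

/-! ### Negligible vectors -/

section Negligible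

variable {E : Type*} [NormedAddCommGroup E] [InnerProductSpace ℂ E] {V : E →ₗᵢ[ℂ] E}

theorem pow_add_apply (V : E →ₗᵢ[ℂ] E) (j k : ℕ) (g : E) :
    (V ^ (j + k)) g = (V ^ j) ((V ^ k) g) := by
  rw [pow_add, LinearIsometry.coe_mul, Function.comp_apply]

theorem pow_apply_of_eigenvector {v : E} {ξ : ℂ} (hv : V v = ξ • v) (k : ℕ) :
    (V ^ k) v = ξ ^ k • v := by
  induction k with
  | zero => simp
  | succ k ih => rw [pow_add_apply, pow_one, hv, map_smul, ih, smul_smul, pow_succ']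

theorem norm_eigenvalue {v : E} {ξ : ℂ} (hv : V v = ξ • v) (hv0 : v ≠ 0) : ‖ξ‖ = 1 := by
  have h := V.norm_map v
  rwa [hv, norm_smul, mul_eq_right₀ (norm_ne_zero_iff.2 hv0)] at h

theorem inner_eigenvector_pow {v : E} {ξ : ℂ} (hv : V v = ξ • v) (hv0 : v ≠ 0) (k : ℕ) (g : E) :
    inner ℂ v ((V ^ k) g) = ξ ^ k * inner ℂ v g := by
  have hξ : ξ ^ k * starRingEnd ℂ (ξ ^ k) = 1 :=
    (mul_conj_eq_one_iff (by simp [norm_eigenvalue hv hv0])).2 rfl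
  rw [← (V ^ k).inner_map_map v g, pow_apply_of_eigenvector hv, inner_smul_left, ← mul_assoc, hξ,
    one_mul]

theorem norm_inner_pow_pow (V : E →ₗᵢ[ℂ] E) (g : E) (j k : ℕ) :
    ‖inner ℂ ((V ^ j) g) ((V ^ k) g)‖ = ‖inner ℂ g ((V ^ Nat.dist j k) g)‖ := by
  wlog h : j ≤ k generalizing j k
  · rw [norm_inner_symm, this k j (le_of_not_ge h), Nat.dist_comm]
  obtain ⟨d, rfl⟩ := Nat.exists_eq_add_of_le h
  rw [pow_add_apply, (V ^ j).inner_map_map, Nat.dist_eq_sub_of_le h, Nat.add_sub_cancel_left]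

theorem sum_range_dist_le {ρ : ℕ → ℝ} (hρ : ∀ l, 0 ≤ ρ l) {N j : ℕ} (hj : j < N) :
    ∑ k ∈ Finset.range N, ρ (Nat.dist j k) ≤ 2 * ∑ l ∈ Finset.range N, ρ l := by
  have hmono {m : ℕ} (hm : m ≤ N) : ∑ l ∈ Finset.range m, ρ l ≤ ∑ l ∈ Finset.range N, ρ l :=
    Finset.sum_le_sum_of_subset_of_nonneg (Finset.range_mono hm) fun _ _ _ => hρ _
  have hbefore : ∑ k ∈ Finset.range j, ρ (Nat.dist j k) ≤ ∑ l ∈ Finset.range N, ρ l :=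
    calc ∑ k ∈ Finset.range j, ρ (Nat.dist j k)
        ≤ ∑ k ∈ Finset.range (j + 1), ρ (Nat.dist j k) :=
          Finset.sum_le_sum_of_subset_of_nonneg (Finset.range_mono j.le_succ) fun _ _ _ => hρ _
      _ = ∑ k ∈ Finset.range (j + 1), ρ (j - k) := Finset.sum_congr rfl fun k hk => by
          rw [Nat.dist_eq_sub_of_le_right (Finset.mem_range_succ_iff.1 hk)]
      _ = ∑ l ∈ Finset.range (j + 1), ρ l := Finset.sum_flip ρ
      _ ≤ ∑ l ∈ Finset.range N, ρ l := hmono hj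
  have hafter : ∑ k ∈ Finset.Ico j N, ρ (Nat.dist j k) ≤ ∑ l ∈ Finset.range N, ρ l := by
    rw [Finset.sum_Ico_eq_sum_range]
    simpa [Nat.dist_eq_sub_of_le] using hmono (N.sub_le j)
  rw [← Finset.sum_range_add_sum_Ico _ hj.le]
  linarith

/-- The combination `∑ l, conj (c l) • V ^ l` of powers of `V`. The conjugate makes
`‖orbitSum V c g‖ ^ 2` the quadratic form of the Gram matrix of the orbit of `g`. -/
def orbitSum (V : E →ₗᵢ[ℂ] E) {N : ℕ} (c : EuclideanSpace ℂ (Fin N)) : E →ₗ[ℂ] E :=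
  ∑ l : Fin N, starRingEnd ℂ (c l) • (V ^ (l : ℕ)).toLinearMap

theorem orbitSum_apply {N : ℕ} (c : EuclideanSpace ℂ (Fin N)) (g : E) :
    orbitSum V c g = ∑ l : Fin N, starRingEnd ℂ (c l) • (V ^ (l : ℕ)) g := by
  simp [orbitSum]

theorem orbitSum_eigenvector {v : E} {ξ : ℂ} (hv : V v = ξ • v) {N : ℕ}
    (c : EuclideanSpace ℂ (Fin N)) : orbitSum V c v = inner ℂ c (expVec ξ N) • v := by
  simp only [orbitSum_apply, pow_apply_of_eigenvector hv, smul_smul, ← Finset.sum_smul,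
    PiLp.inner_apply, expVec, RCLike.inner_apply, mul_comm]

theorem inner_eigenvector_orbitSum {v : E} {ξ : ℂ} (hv : V v = ξ • v) (hv0 : v ≠ 0) {N : ℕ}
    (c : EuclideanSpace ℂ (Fin N)) (g : E) :
    inner ℂ v (orbitSum V c g) = inner ℂ c (expVec ξ N) * inner ℂ v g := by
  simp only [orbitSum_apply, inner_sum, inner_smul_right, inner_eigenvector_pow hv hv0,
    PiLp.inner_apply, expVec, RCLike.inner_apply, Finset.sum_mul]
  exact Finset.sum_congr rfl fun _ _ => by ring

theorem norm_orbitSum_le {N : ℕ} (c : EuclideanSpace ℂ (Fin N)) (g : E) :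
    ‖orbitSum V c g‖ ≤ ‖g‖ * √N * ‖c‖ := by
  have hc : ∑ l, ‖c l‖ ≤ √N * ‖c‖ := by
    refine le_of_sq_le_sq ?_ (by positivity)
    rw [mul_pow, Real.sq_sqrt (Nat.cast_nonneg N), EuclideanSpace.norm_sq_eq]
    simpa using sq_sum_le_card_mul_sum_sq (s := Finset.univ) (f := fun l => ‖c l‖)
  calc ‖orbitSum V c g‖ ≤ ∑ l, ‖c l‖ * ‖g‖ := by
        rw [orbitSum_apply]
        exact norm_sum_le_of_le _ fun l _ => by simp [norm_smul]
    _ = (∑ l, ‖c l‖) * ‖g‖ := (Finset.sum_mul ..).symm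
    _ ≤ (√N * ‖c‖) * ‖g‖ := by gcongr
    _ = ‖g‖ * √N * ‖c‖ := by ring

theorem norm_orbitSum_sq_le {N : ℕ} (c : EuclideanSpace ℂ (Fin N)) (g : E) :
    ‖orbitSum V c g‖ ^ 2 ≤
      (2 * ∑ l ∈ Finset.range N, ‖inner ℂ g ((V ^ l) g)‖) * ‖c‖ ^ 2 := by
  have hrow (j : Fin N) : ∑ k : Fin N, ‖inner ℂ ((V ^ (j : ℕ)) g) ((V ^ (k : ℕ)) g)‖ ≤
      2 * ∑ l ∈ Finset.range N, ‖inner ℂ g ((V ^ l) g)‖ := by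
    simp only [norm_inner_pow_pow]
    rw [Fin.sum_univ_eq_sum_range fun k => ‖inner ℂ g ((V ^ Nat.dist j k) g)‖]
    exact sum_range_dist_le (ρ := fun l => ‖inner ℂ g ((V ^ l) g)‖) (fun _ => norm_nonneg _) j.2
  rw [orbitSum_apply, EuclideanSpace.norm_sq_eq]
  simpa using norm_sum_smul_sq_le hrow fun l => starRingEnd ℂ (c l)

/-- Vectors `g` for which the norm of `c ↦ ∑_{l < N} conj (c l) • V ^ l g` is `o(√N)`. They do not
contribute to the leading order of the eigenvalues of the Gram matrices of orbits. -/
def IsNegligible (V : E →ₗᵢ[ℂ] E) (g : E) : Prop :=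
  ∀ ε > 0, ∀ᶠ N : ℕ in atTop, ∀ c : EuclideanSpace ℂ (Fin N), ‖orbitSum V c g‖ ≤ ε * √N * ‖c‖

theorem IsNegligible.add {g h : E} (hg : IsNegligible V g) (hh : IsNegligible V h) :
    IsNegligible V (g + h) := by
  intro ε hε
  filter_upwards [hg (ε / 2) (half_pos hε), hh (ε / 2) (half_pos hε)] with N hgN hhN c
  rw [map_add]
  linarith [norm_add_le (orbitSum V c g) (orbitSum V c h), hgN c, hhN c]

theorem isNegligible_of_tendsto {g : E}
    (h : Tendsto (fun N : ℕ => (N : ℝ)⁻¹ * ∑ l ∈ Finset.range N, ‖inner ℂ g ((V ^ l) g)‖ ^ 2)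
      atTop (𝓝 0)) : IsNegligible V g := by
  intro ε hε
  filter_upwards [h.eventually_le_const (show 0 < ε ^ 4 / 4 by positivity),
    eventually_gt_atTop 0] with N hN hN0 c
  have hN0' : (0 : ℝ) < N := Nat.cast_pos.2 hN0
  let S := ∑ l ∈ Finset.range N, ‖inner ℂ g ((V ^ l) g)‖
  have hS : S ≤ ε ^ 2 / 2 * N := by
    refine le_of_sq_le_sq ?_ (by positivity)
    calc S ^ 2 ≤ N * ∑ l ∈ Finset.range N, ‖inner ℂ g ((V ^ l) g)‖ ^ 2 := by
          simpa using sq_sum_le_card_mul_sum_sq (s := Finset.range N)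
            (f := fun l => ‖inner ℂ g ((V ^ l) g)‖)
      _ ≤ N * (N * (ε ^ 4 / 4)) := by
          gcongr
          exact (inv_mul_le_iff₀ hN0').1 hN
      _ = (ε ^ 2 / 2 * N) ^ 2 := by ring
  refine le_of_sq_le_sq ?_ (by positivity)
  calc ‖orbitSum V c g‖ ^ 2 ≤ 2 * S * ‖c‖ ^ 2 := norm_orbitSum_sq_le c g
    _ ≤ 2 * (ε ^ 2 / 2 * N) * ‖c‖ ^ 2 := by gcongr
    _ = (ε * √N * ‖c‖) ^ 2 := by
      rw [mul_pow, mul_pow, Real.sq_sqrt hN0'.le]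
      ring

theorem IsNegligible.inner_eigenvector {g v : E} (hg : IsNegligible V g) {ξ : ℂ}
    (hv : V v = ξ • v) : inner ℂ v g = 0 := by
  rcases eq_or_ne v 0 with rfl | hv0
  · exact inner_zero_left g
  have hξ := norm_eigenvalue hv hv0
  have hbound {ε : ℝ} (hε : 0 < ε) : ‖inner ℂ v g‖ ≤ ε * ‖v‖ := by
    obtain ⟨N, hN, hN0⟩ := ((hg ε hε).and (eventually_gt_atTop 0)).exists
    have hN0' : (0 : ℝ) < N := Nat.cast_pos.2 hN0
    refine le_of_mul_le_mul_left ?_ hN0'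
    have hself : inner ℂ (expVec ξ N) (expVec ξ N) = (N : ℂ) := by
      rw [inner_expVec, (mul_conj_eq_one_iff hξ).2 rfl]
      simp
    calc N * ‖inner ℂ v g‖ = ‖inner ℂ v (orbitSum V (expVec ξ N) g)‖ := by
          rw [inner_eigenvector_orbitSum hv hv0, hself, norm_mul, Complex.norm_natCast]
      _ ≤ ‖v‖ * ‖orbitSum V (expVec ξ N) g‖ := norm_inner_le_norm _ _
      _ ≤ ‖v‖ * (ε * √N * √N) := by
          gcongr
          simpa only [norm_expVec hξ] using hN (expVec ξ N)
      _ = N * (ε * ‖v‖) := by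
          rw [mul_assoc ε, Real.mul_self_sqrt hN0'.le]
          ring
  have hlim : Tendsto (fun ε : ℝ => ε * ‖v‖) (𝓝[>] 0) (𝓝 0) := by
    simpa using (tendsto_nhdsWithin_of_tendsto_nhds (tendsto_id (x := 𝓝 (0 : ℝ)))).mul_const ‖v‖
  exact norm_le_zero_iff.1 (ge_of_tendsto hlim (eventually_mem_nhdsWithin.mono fun _ => hbound))

end Negligible

section NonUnitaryPart

variable {E : Type*} [NormedAddCommGroup E] [InnerProductSpace ℂ E] {V : E →ₗᵢ[ℂ] E}

theorem antitone_range_pow (V : E →ₗᵢ[ℂ] E) :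
    Antitone fun k : ℕ => LinearMap.range (V ^ k).toLinearMap := by
  refine antitone_nat_of_succ_le fun k => ?_
  rintro _ ⟨x, rfl⟩
  exact ⟨V x, (pow_add_apply V k 1 x).symm⟩

theorem isClosed_range_pow [CompleteSpace E] (V : E →ₗᵢ[ℂ] E) (k : ℕ) :
    IsClosed (LinearMap.range (V ^ k).toLinearMap : Set E) :=
  (V ^ k).isometry.isClosedEmbedding.isClosed_range

theorem nonUnitaryPart_eq_topologicalClosure [CompleteSpace E] (V : E →ₗᵢ[ℂ] E) :
    nonUnitaryPart V =
      (⨆ k : ℕ, (LinearMap.range (V ^ k).toLinearMap)ᗮ).topologicalClosure := by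
  rw [← Submodule.orthogonal_orthogonal_eq_closure, ← Submodule.iInf_orthogonal, nonUnitaryPart,
    unitaryPart]
  congr! 3 with k
  rw [Submodule.orthogonal_orthogonal_eq_closure,
    (isClosed_range_pow V k).submodule_topologicalClosure_eq]

theorem tendsto_inner_pow_of_mem_nonUnitaryPart [CompleteSpace E] {g : E}
    (hg : g ∈ nonUnitaryPart V) (h : E) :
    Tendsto (fun l : ℕ => inner ℂ g ((V ^ l) h)) atTop (𝓝 0) := by
  rw [nonUnitaryPart_eq_topologicalClosure, ← SetLike.mem_coe, Submodule.topologicalClosure_coe,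
    Metric.mem_closure_iff] at hg
  have horth : Monotone fun k : ℕ => (LinearMap.range (V ^ k).toLinearMap)ᗮ :=
    fun _ _ hkl => Submodule.orthogonal_le (antitone_range_pow V hkl)
  rw [Metric.tendsto_atTop]
  intro ε hε
  obtain ⟨y, hy, hgy⟩ := hg (ε / (‖h‖ + 1)) (by positivity)
  rw [SetLike.mem_coe, Submodule.mem_iSup_of_directed _ horth.directed_le] at hy
  obtain ⟨k, hk⟩ := hy
  refine ⟨k, fun l hl => ?_⟩
  have hyl : inner ℂ y ((V ^ l) h) = 0 := (Submodule.mem_orthogonal' _ _).1 (horth hl hk) _ ⟨h, rfl⟩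
  calc dist (inner ℂ g ((V ^ l) h)) 0 = ‖inner ℂ (g - y) ((V ^ l) h)‖ := by
        rw [dist_zero_right, inner_sub_left, hyl, sub_zero]
    _ ≤ ‖g - y‖ * ‖h‖ := (norm_inner_le_norm _ _).trans_eq (by rw [(V ^ l).norm_map])
    _ ≤ ε / (‖h‖ + 1) * ‖h‖ := by
        gcongr
        exact dist_eq_norm g y ▸ hgy.le
    _ < ε := by
        rw [div_mul_eq_mul_div, div_lt_iff₀ (by positivity)]
        linarith

theorem isNegligible_of_mem_nonUnitaryPart [CompleteSpace E] {g : E}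
    (hg : g ∈ nonUnitaryPart V) : IsNegligible V g := by
  refine isNegligible_of_tendsto (Tendsto.cesaro ?_)
  simpa using (tendsto_inner_pow_of_mem_nonUnitaryPart hg g).norm.pow 2

end NonUnitaryPart

/-! ### Wiener's lemma -/

theorem norm_sq_integral_pow (ν : Measure Circle) [IsFiniteMeasure ν] (l : ℕ) :
    ((‖∫ z : Circle, (z : ℂ) ^ l ∂ν‖ ^ 2 : ℝ) : ℂ) =
      ∫ p : Circle × Circle, ((p.1 / p.2 : Circle) : ℂ) ^ l ∂(ν.prod ν) := by
  have hsplit (p : Circle × Circle) :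
      ((p.1 / p.2 : Circle) : ℂ) ^ l = (p.1 : ℂ) ^ l * starRingEnd ℂ ((p.2 : ℂ) ^ l) := by
    rw [div_eq_mul_inv, Circle.coe_mul, Circle.coe_inv_eq_conj, mul_pow, map_pow]
  simp only [hsplit]
  rw [integral_prod_mul (fun z : Circle => (z : ℂ) ^ l)
    fun w : Circle => starRingEnd ℂ ((w : ℂ) ^ l), integral_conj, Complex.mul_conj,
    Complex.normSq_eq_norm_sq]

theorem tendsto_average_norm_sq_integral_pow (ν : Measure Circle) [IsFiniteMeasure ν] :
    Tendsto (fun N : ℕ => (N : ℝ)⁻¹ * ∑ l ∈ Finset.range N, ‖∫ z : Circle, (z : ℂ) ^ l ∂ν‖ ^ 2)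
      atTop (𝓝 ((ν.prod ν).real (Set.diagonal Circle))) := by
  classical
  have hcont : Continuous fun p : Circle × Circle => ((p.1 / p.2 : Circle) : ℂ) :=
    continuous_subtype_val.comp (Continuous.div' continuous_fst continuous_snd : Continuous
      fun p : Circle × Circle => p.1 / p.2)
  have hdiag (p : Circle × Circle) :
      ((p.1 / p.2 : Circle) : ℂ) = 1 ↔ p ∈ Set.diagonal Circle := by
    rw [Circle.coe_eq_one, div_eq_one, Set.mem_diagonal_iff]
  have hlim : Tendsto (fun N : ℕ => ∫ p : Circle × Circle,
      (N : ℂ)⁻¹ * ∑ l ∈ Finset.range N, ((p.1 / p.2 : Circle) : ℂ) ^ l ∂(ν.prod ν))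
      atTop (𝓝 (∫ p, (Set.diagonal Circle).indicator (fun _ => (1 : ℂ)) p ∂(ν.prod ν))) := by
    refine tendsto_integral_of_dominated_convergence (fun _ => 1)
      (fun N => Continuous.aestronglyMeasurable (by fun_prop)) (integrable_const _)
      (fun N => .of_forall fun p => ?_) (.of_forall fun p => ?_)
    · calc _ ≤ (N : ℝ)⁻¹ * N := by
            rw [norm_mul, norm_inv, Complex.norm_natCast]
            gcongr
            exact (norm_sum_le _ _).trans_eq (by simp only [norm_pow, Circle.norm_coe]; simp)
        _ ≤ 1 := inv_mul_le_one
    · convert tendsto_average_pow (Circle.norm_coe (p.1 / p.2)).le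
      exact (Set.indicator_apply ..).trans (if_congr (hdiag p).symm rfl rfl)
  rw [integral_indicator_const (1 : ℂ) measurableSet_diagonal, Complex.real_smul, mul_one] at hlim
  have hval (N : ℕ) : ∫ p : Circle × Circle,
      (N : ℂ)⁻¹ * ∑ l ∈ Finset.range N, ((p.1 / p.2 : Circle) : ℂ) ^ l ∂(ν.prod ν) =
      ((N : ℝ)⁻¹ * ∑ l ∈ Finset.range N, ‖∫ z : Circle, (z : ℂ) ^ l ∂ν‖ ^ 2 : ℝ) := by
    rw [integral_const_mul, integral_finsetSum _ fun l _ => ?_]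
    · simp only [← norm_sq_integral_pow]
      push_cast
      rfl
    · exact Integrable.of_bound (C := 1) (hcont.pow l).aestronglyMeasurable
        (.of_forall fun p => by rw [norm_pow, Circle.norm_coe, one_pow])
  simp only [hval] at hlim
  exact tendsto_ofReal_iff.1 hlim

theorem prod_diagonal_eq_zero {X : Type*} [MeasurableSpace X] [MeasurableEq X] (μ : Measure X)
    {ν : Measure X} [SFinite ν] (hν : ∀ x, ν {x} = 0) : μ.prod ν (Set.diagonal X) = 0 := by
  rw [Measure.prod_apply measurableSet_diagonal]
  have hslice (x : X) : Prod.mk x ⁻¹' Set.diagonal X = {x} := by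
    ext y
    simp [eq_comm]
  simp [hslice, hν]

theorem arcLength_singleton (z : Circle) : arcLength {z} = 0 := by
  rw [arcLength, Measure.map_apply (by fun_prop) (measurableSet_singleton z),
    Measure.restrict_apply (Circle.exp.continuous.measurable (measurableSet_singleton z))]
  refine Set.Subsingleton.measure_zero (fun x hx y hy => ?_) _
  have h : Circle.exp x = Circle.exp y := hx.1.trans hy.1.symm
  rw [← Circle.arg_exp hx.2.1 hx.2.2, h, Circle.arg_exp hy.2.1 hy.2.2]

section ContinuousParts

variable {E : Type*} [NormedAddCommGroup E] [InnerProductSpace ℂ E] {V : E →ₗᵢ[ℂ] E} {g : E}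

theorem IsSpectralMeasure.isNegligible {ν : Measure Circle} (h : IsSpectralMeasure V g ν)
    (hν : ∀ z : Circle, ν {z} = 0) : IsNegligible V g := by
  have := h.1
  refine isNegligible_of_tendsto ?_
  simpa [h.2, measureReal_def, prod_diagonal_eq_zero ν hν] using
    tendsto_average_norm_sq_integral_pow ν

theorem isNegligible_of_mem_absolutelyContinuousPart (hg : g ∈ absolutelyContinuousPart V) :
    IsNegligible V g := by
  obtain ⟨-, ν, hν, hac⟩ := hg
  exact hν.isNegligible fun z => hac (arcLength_singleton z)

theorem isNegligible_of_mem_singularContinuousPart (hg : g ∈ singularContinuousPart V) :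
    IsNegligible V g := by
  obtain ⟨-, ν, hν, hatom, -⟩ := hg
  exact hν.isNegligible hatom

end ContinuousParts

/-! ### Gram matrices of orbits -/

section OrbitGram

variable {E : Type*} [NormedAddCommGroup E] [InnerProductSpace ℂ E] {V : E →ₗᵢ[ℂ] E}

/-- The Gram matrix of `g, V g, …, V ^ (N - 1) g`. The entry `(i, j)` is `⟪V ^ j g, V ^ i g⟫`, as
for the Gram matrices of a time series, whose inner product is linear in the first argument. -/
def orbitGram (V : E →ₗᵢ[ℂ] E) (g : E) (N : ℕ) : Matrix (Fin N) (Fin N) ℂ :=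
  Matrix.of fun i j => inner ℂ ((V ^ (j : ℕ)) g) ((V ^ (i : ℕ)) g)

theorem orbitGram_isHermitian (V : E →ₗᵢ[ℂ] E) (g : E) (N : ℕ) : (orbitGram V g N).IsHermitian := by
  ext i j
  simp [orbitGram, Matrix.conjTranspose_apply]

/-- The eigenvalues of `orbitGram V g N` in nonincreasing order with multiplicity, extended by `0`
to all indices. -/
def orbitGramEigenvalue (V : E →ₗᵢ[ℂ] E) (g : E) (N i : ℕ) : ℝ :=
  if h : i < N then (orbitGram_isHermitian V g N).eigenvalues₀ ⟨i, by simpa using h⟩ else 0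

theorem re_inner_orbitGram (g : E) {N : ℕ} (c : EuclideanSpace ℂ (Fin N)) :
    RCLike.re (inner ℂ (Matrix.toEuclideanLin (orbitGram V g N) c) c) = ‖orbitSum V c g‖ ^ 2 := by
  have hform : inner ℂ (Matrix.toEuclideanLin (orbitGram V g N) c) c =
      starRingEnd ℂ (inner ℂ (orbitSum V c g) (orbitSum V c g)) := by
    simp only [orbitSum_apply, sum_inner, inner_sum, inner_smul_left, inner_smul_right, map_sum,
      PiLp.inner_apply, Matrix.toLpLin_apply, Matrix.mulVec, dotProduct, orbitGram,
      Matrix.of_apply, RCLike.inner_apply, map_mul, inner_conj_symm, starRingEnd_self_apply,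
      Finset.mul_sum]
    exact Finset.sum_congr rfl fun _ _ => Finset.sum_congr rfl fun _ _ => by ring
  rw [hform, RCLike.conj_re, inner_self_eq_norm_sq]

theorem le_orbitGramEigenvalue_of_lt_finrank {g : E} {N i : ℕ}
    {W : Submodule ℂ (EuclideanSpace ℂ (Fin N))} (hW : i < Module.finrank ℂ W) {b : ℝ}
    (h : ∀ c ∈ W, b * ‖c‖ ^ 2 ≤ ‖orbitSum V c g‖ ^ 2) : b ≤ orbitGramEigenvalue V g N i := by
  have hi : i < N := hW.trans_le (by simpa using W.finrank_le)
  rw [orbitGramEigenvalue, dif_pos hi]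
  refine le_eigenvalues_of_lt_finrank _ _ hW fun c hc => ?_
  rw [re_inner_orbitGram]
  exact h c hc

theorem orbitGramEigenvalue_le_of_le_finrank_add {g : E} {N i : ℕ}
    {W : Submodule ℂ (EuclideanSpace ℂ (Fin N))} (hW : N ≤ Module.finrank ℂ W + i) {b : ℝ}
    (hb : 0 ≤ b) (h : ∀ c ∈ W, ‖orbitSum V c g‖ ^ 2 ≤ b * ‖c‖ ^ 2) :
    orbitGramEigenvalue V g N i ≤ b := by
  rw [orbitGramEigenvalue]
  split_ifs with hi
  · refine eigenvalues_le_of_le_finrank_add _ _ (by simpa using hW) fun c hc => ?_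
    rw [re_inner_orbitGram]
    exact h c hc
  · exact hb

theorem orbitGramEigenvalue_nonneg (V : E →ₗᵢ[ℂ] E) (g : E) (N i : ℕ) :
    0 ≤ orbitGramEigenvalue V g N i := by
  by_cases hi : i < N
  · refine le_orbitGramEigenvalue_of_lt_finrank (W := ⊤) (by simpa using hi) fun c _ => ?_
    rw [zero_mul]
    positivity
  · rw [orbitGramEigenvalue, dif_neg hi]

variable {ι : Type*} [Fintype ι] {v : ι → E} {ξ : ι → ℂ}

theorem norm_orbitSum_sum_smul_sq (hv : Orthonormal ℂ v) (hV : ∀ j, V (v j) = ξ j • v j) {N : ℕ}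
    (c : EuclideanSpace ℂ (Fin N)) (b : ι → ℂ) :
    ‖orbitSum V c (∑ j, b j • v j)‖ ^ 2 =
      ∑ j, ‖b j‖ ^ 2 * ‖inner ℂ (expVec (ξ j) N) c‖ ^ 2 := by
  have hcoeff : orbitSum V c (∑ j, b j • v j) = ∑ j, (b j * inner ℂ c (expVec (ξ j) N)) • v j := by
    simp only [map_sum, map_smul, orbitSum_eigenvector (hV _), smul_smul]
  rw [hcoeff, @norm_sq_eq_re_inner ℂ, hv.inner_sum, map_sum]
  refine Finset.sum_congr rfl fun j _ => ?_
  rw [RCLike.conj_mul, norm_mul, norm_inner_symm, ← RCLike.ofReal_pow, RCLike.ofReal_re, mul_pow]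

theorem eventually_le_orbitGramEigenvalue (hv : Orthonormal ℂ v)
    (hV : ∀ j, V (v j) = ξ j • v j) (hξ : Function.Injective ξ) {g : E} {α : ℝ} (hα : 0 ≤ α)
    (hg : ∀ j, α ≤ ‖inner ℂ (v j) g‖ ^ 2) {δ : ℝ} (hδ : 0 < δ) (hδ' : δ < 1) {i : ℕ}
    (hi : i < Fintype.card ι) :
    ∀ᶠ N : ℕ in atTop, α * (1 - δ) * N ≤ orbitGramEigenvalue V g N i := by
  have hnorm (j : ι) : ‖ξ j‖ = 1 := norm_eigenvalue (hV j) (hv.ne_zero j)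
  filter_upwards [eventually_abs_norm_sum_smul_expVec_sq_sub_le hξ hnorm hδ,
    eventually_gt_atTop 0] with N hN hN0
  have hA : 0 < (1 - δ) * N := mul_pos (sub_pos.2 hδ') (Nat.cast_pos.2 hN0)
  have hlower (s : ι → ℂ) :
      (1 - δ) * N * ∑ j, ‖s j‖ ^ 2 ≤ ‖∑ j, s j • expVec (ξ j) N‖ ^ 2 := by
    linarith [(abs_le.1 (hN s)).1]
  have hrank := finrank_span_eq_card (linearIndependent_of_mul_sum_sq_le hA hlower)
  refine le_orbitGramEigenvalue_of_lt_finrank (hi.trans_eq hrank.symm) fun c hc => ?_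
  calc α * (1 - δ) * N * ‖c‖ ^ 2 = α * ((1 - δ) * N * ‖c‖ ^ 2) := by ring
    _ ≤ α * ∑ j, ‖inner ℂ (expVec (ξ j) N) c‖ ^ 2 := by
      gcongr
      exact mul_norm_sq_le_sum_norm_inner_sq hA.le hlower hc
    _ ≤ ∑ j, ‖inner ℂ (v j) (orbitSum V c g)‖ ^ 2 := by
      rw [Finset.mul_sum]
      refine Finset.sum_le_sum fun j _ => ?_
      rw [inner_eigenvector_orbitSum (hV j) (hv.ne_zero j), norm_mul, mul_pow, norm_inner_symm,
        mul_comm]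
      gcongr
      exact hg j
    _ ≤ ‖orbitSum V c g‖ ^ 2 := hv.sum_inner_products_le _

theorem norm_orbitSum_sum_smul_sq_le (hv : Orthonormal ℂ v) (hV : ∀ j, V (v j) = ξ j • v j) {N : ℕ}
    {B : ℝ} (hB : 0 ≤ B)
    (hupper : ∀ t : ι → ℂ, ‖∑ j, t j • expVec (ξ j) N‖ ^ 2 ≤ B * ∑ j, ‖t j‖ ^ 2)
    {b : ι → ℂ} {s : Finset ι} {A : ℝ} (hb : ∀ j ∉ s, ‖b j‖ ≤ A)
    {c : EuclideanSpace ℂ (Fin N)} (hc : ∀ j ∈ s, inner ℂ (expVec (ξ j) N) c = 0) :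
    ‖orbitSum V c (∑ j, b j • v j)‖ ^ 2 ≤ A ^ 2 * (B * ‖c‖ ^ 2) := by
  calc ‖orbitSum V c (∑ j, b j • v j)‖ ^ 2
      = ∑ j, ‖b j‖ ^ 2 * ‖inner ℂ (expVec (ξ j) N) c‖ ^ 2 :=
        norm_orbitSum_sum_smul_sq hv hV c b
    _ ≤ ∑ j, A ^ 2 * ‖inner ℂ (expVec (ξ j) N) c‖ ^ 2 := by
      refine Finset.sum_le_sum fun j _ => ?_
      by_cases hj : j ∈ s
      · simp [hc j hj]
      · gcongr
        exact hb j hj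
    _ ≤ A ^ 2 * (B * ‖c‖ ^ 2) := by
      rw [← Finset.mul_sum]
      gcongr
      exact sum_norm_inner_sq_le hB hupper c

theorem le_finrank_orthogonal_span_image_add {κ : Type*} {N : ℕ}
    (w : κ → EuclideanSpace ℂ (Fin N)) (s : Finset κ) :
    N ≤ Module.finrank ℂ (Submodule.span ℂ (w '' s))ᗮ + s.card := by
  classical
  have hle : Module.finrank ℂ (Submodule.span ℂ (w '' s)) ≤ s.card :=
    (Finset.coe_image (f := w) ▸ finrank_span_finset_le_card _).trans Finset.card_image_le
  have hadd := (Submodule.span ℂ (w '' s)).finrank_add_finrank_orthogonal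
  rw [finrank_euclideanSpace_fin] at hadd
  omega

theorem eventually_orbitGramEigenvalue_le (hv : Orthonormal ℂ v)
    (hV : ∀ j, V (v j) = ξ j • v j) (hξ : Function.Injective ξ) {b : ι → ℂ} {s : Finset ι} {A : ℝ}
    (hA : 0 ≤ A) (hb : ∀ j ∉ s, ‖b j‖ ≤ A) {r : E} {ε : ℝ} (hε : 0 < ε)
    (hr : ∀ᶠ N : ℕ in atTop, ∀ c : EuclideanSpace ℂ (Fin N), ‖orbitSum V c r‖ ≤ ε * √N * ‖c‖)
    {i : ℕ} (hi : s.card ≤ i) :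
    ∀ᶠ N : ℕ in atTop,
      orbitGramEigenvalue V (∑ j, b j • v j + r) N i ≤ (A * (1 + ε) + ε) ^ 2 * N := by
  have hnorm (j : ι) : ‖ξ j‖ = 1 := norm_eigenvalue (hV j) (hv.ne_zero j)
  filter_upwards [eventually_abs_norm_sum_smul_expVec_sq_sub_le hξ hnorm hε, hr] with N hN hrN
  have hupper (t : ι → ℂ) :
      ‖∑ j, t j • expVec (ξ j) N‖ ^ 2 ≤ (1 + ε) * N * ∑ j, ‖t j‖ ^ 2 := by
    linarith [(abs_le.1 (hN t)).2]
  refine orbitGramEigenvalue_le_of_le_finrank_add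
    ((le_finrank_orthogonal_span_image_add (fun j => expVec (ξ j) N) s).trans (by gcongr))
    (by positivity) fun c hc => ?_
  have hpoint : ‖orbitSum V c (∑ j, b j • v j)‖ ≤ A * (1 + ε) * √N * ‖c‖ := by
    refine le_of_sq_le_sq ?_ (by positivity)
    calc ‖orbitSum V c (∑ j, b j • v j)‖ ^ 2 ≤ A ^ 2 * ((1 + ε) * N * ‖c‖ ^ 2) :=
          norm_orbitSum_sum_smul_sq_le hv hV (by positivity) hupper hb fun j hj =>
            hc _ (Submodule.subset_span (Set.mem_image_of_mem _ hj))
      _ ≤ A ^ 2 * ((1 + ε) ^ 2 * N * ‖c‖ ^ 2) := by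
        gcongr
        exact le_self_pow₀ (by linarith) two_ne_zero
      _ = (A * (1 + ε) * √N * ‖c‖) ^ 2 := by
        rw [mul_pow, mul_pow _ √N, Real.sq_sqrt N.cast_nonneg]
        ring
  calc ‖orbitSum V c (∑ j, b j • v j + r)‖ ^ 2
      ≤ (A * (1 + ε) * √N * ‖c‖ + ε * √N * ‖c‖) ^ 2 := by
        rw [map_add]
        gcongr
        exact (norm_add_le _ _).trans (add_le_add hpoint (hrN c))
    _ = (A * (1 + ε) + ε) ^ 2 * N * ‖c‖ ^ 2 := by
        rw [← add_mul, ← add_mul, mul_pow, mul_pow, Real.sq_sqrt N.cast_nonneg]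

end OrbitGram

/-! ### Eigenvalue asymptotics -/

theorem inner_eq_of_hasSum_smul {𝕜 E ι : Type*} [RCLike 𝕜] [NormedAddCommGroup E]
    [InnerProductSpace 𝕜 E] {v : ι → E} (hv : Orthonormal 𝕜 v) {a : ι → 𝕜} {x : E}
    (h : HasSum (fun i => a i • v i) x) (i : ι) : inner 𝕜 (v i) x = a i := by
  classical
  have hinner := (innerSL 𝕜 (v i)).hasSum h
  simp only [innerSL_apply_apply, inner_smul_right, orthonormal_iff_ite.1 hv, mul_ite, mul_one,
    mul_zero] at hinner
  refine hinner.unique ?_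
  convert hasSum_single i fun j hj => if_neg hj.symm
  exact (if_pos rfl).symm

namespace SpectralDecomposition

variable {E : Type*} [NormedAddCommGroup E] [InnerProductSpace ℂ E] {V : E →ₗᵢ[ℂ] E} {g : E}

/-- The indices of the eigenvectors of a decomposition. -/
abbrev Index (D : SpectralDecomposition V g) : Type := {i : ℕ // (i : ℕ∞) < D.n}

theorem hasSum_index (D : SpectralDecomposition V g) :
    HasSum (fun j : D.Index => D.a j • D.v j)
      (g - (D.gsc + D.gac + D.gnu)) := by
  have hsum := D.hasSum
  rw [sub_sub, sub_sub, ← add_assoc] at hsum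
  refine (hasSum_subtype_iff_of_support_subset (s := {i : ℕ | (i : ℕ∞) < D.n})
    fun i hi => ?_).2 hsum
  by_contra hin
  exact hi (smul_eq_zero_of_left (D.coeff_eq_zero i (not_lt.1 hin)) _)

theorem exists_injective_eigenvalue (D : SpectralDecomposition V g) :
    ∃ ξ : D.Index → ℂ,
      Function.Injective ξ ∧ ∀ j : D.Index, V (D.v j) = ξ j • D.v j := by
  choose ξ hξ using fun j : D.Index => D.eigenvector j j.2
  refine ⟨ξ, fun j k hjk => ?_, hξ⟩
  by_contra hne
  have hinner := orthonormal_iff_ite.1 D.orthonormal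
  have hj : inner ℂ (D.v j) (D.v j + D.v k) = 1 := by
    rw [inner_add_right, hinner, hinner, if_pos rfl, if_neg hne, add_zero]
  have hk : inner ℂ (D.v k) (D.v j + D.v k) = 1 := by
    rw [inner_add_right, hinner, hinner, if_pos rfl, if_neg (Ne.symm hne), zero_add]
  obtain ⟨m, hm, c, hc⟩ := D.complete (D.v j + D.v k)
    (fun h => by simp [h] at hj) ⟨ξ j, by rw [map_add, hξ, hξ, ← hjk, smul_add]⟩
  have hmul (l : D.Index) (hl : inner ℂ (D.v l) (D.v j + D.v k) = 1) :
      l = ⟨m, hm⟩ := by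
    by_contra h
    rw [hc, inner_smul_right, hinner l ⟨m, hm⟩, if_neg h, mul_zero] at hl
    exact zero_ne_one hl
  exact hne ((hmul j hj).trans (hmul k hk).symm)

variable [CompleteSpace E]

theorem isNegligible (D : SpectralDecomposition V g) :
    IsNegligible V (D.gsc + D.gac + D.gnu) :=
  ((isNegligible_of_mem_singularContinuousPart D.gsc_mem).add
    (isNegligible_of_mem_absolutelyContinuousPart D.gac_mem)).add
    (isNegligible_of_mem_nonUnitaryPart D.gnu_mem)

theorem inner_v (D : SpectralDecomposition V g) (j : D.Index) :
    inner ℂ (D.v j) g = D.a j := by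
  obtain ⟨ξ, hξ⟩ := D.eigenvector j j.2
  have h := inner_eq_of_hasSum_smul D.orthonormal D.hasSum_index j
  rwa [inner_sub_right, D.isNegligible.inner_eigenvector hξ, sub_zero] at h

theorem eventually_lt_orbitGramEigenvalue_div (D : SpectralDecomposition V g) {i : ℕ} {y : ℝ}
    (hy : y < ‖D.a i‖ ^ 2) : ∀ᶠ N : ℕ in atTop, y < orbitGramEigenvalue V g N i / N := by
  by_cases hai : D.a i = 0
  · rw [hai, norm_zero, zero_pow two_ne_zero] at hy
    exact .of_forall fun N => hy.trans_le (div_nonneg (orbitGramEigenvalue_nonneg V g N i)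
      N.cast_nonneg)
  have hin : (i : ℕ∞) < D.n := not_le.1 fun h => hai (D.coeff_eq_zero i h)
  obtain ⟨ξ, hinj, hξ⟩ := D.exists_injective_eigenvalue
  obtain ⟨δ, hδy, hδ, hδ1⟩ : ∃ δ, y < ‖D.a i‖ ^ 2 * (1 - δ) ∧ 0 < δ ∧ δ < 1 := by
    have hcont : Tendsto (fun δ : ℝ => ‖D.a i‖ ^ 2 * (1 - δ)) (𝓝[>] 0) (𝓝 (‖D.a i‖ ^ 2)) :=
      (Continuous.tendsto' (by fun_prop) _ _ (by simp)).mono_left nhdsWithin_le_nhds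
    exact ((hcont.eventually_const_lt hy).and (Ioo_mem_nhdsGT one_pos)).exists
  let e (j : Fin (i + 1)) : D.Index :=
    ⟨j, (Nat.cast_le.2 (Nat.lt_succ_iff.1 j.2)).trans_lt hin⟩
  have he : Function.Injective e := fun j k h => Fin.ext (congrArg Subtype.val h)
  have hcoeff (j : Fin (i + 1)) : ‖D.a i‖ ^ 2 ≤ ‖inner ℂ (D.v (e j)) g‖ ^ 2 := by
    rw [D.inner_v]
    gcongr
    exact D.coeff_antitone (Nat.lt_succ_iff.1 j.2)
  filter_upwards [eventually_le_orbitGramEigenvalue (D.orthonormal.comp e he) (fun j => hξ (e j))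
    (hinj.comp he) (sq_nonneg _) hcoeff hδ hδ1 (i := i) (by simp), eventually_gt_atTop 0]
    with N hN hN0
  exact hδy.trans_le ((le_div_iff₀ (Nat.cast_pos.2 hN0)).2 hN)

theorem exists_finset_eventually_norm_orbitSum_sub_le (D : SpectralDecomposition V g) {ε : ℝ}
    (hε : 0 < ε) : ∃ t : Finset D.Index, ∀ᶠ N : ℕ in atTop, ∀ c : EuclideanSpace ℂ (Fin N),
      ‖orbitSum V c (g - ∑ j ∈ t, D.a j • D.v j)‖ ≤ ε * √N * ‖c‖ := by
  have hnhds := Metric.ball_mem_nhds (g - (D.gsc + D.gac + D.gnu)) (half_pos hε)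
  obtain ⟨t, ht⟩ := (D.hasSum_index.eventually hnhds).exists
  have htail : ‖g - (D.gsc + D.gac + D.gnu) - ∑ j ∈ t, D.a j • D.v j‖ < ε / 2 := by
    rwa [← dist_eq_norm, dist_comm]
  have hsplit : g - ∑ j ∈ t, D.a j • D.v j =
      g - (D.gsc + D.gac + D.gnu) - ∑ j ∈ t, D.a j • D.v j + (D.gsc + D.gac + D.gnu) := by
    rw [sub_right_comm, sub_add_cancel]
  refine ⟨t, ?_⟩
  filter_upwards [D.isNegligible (ε / 2) (half_pos hε)] with N hN c
  rw [hsplit, map_add]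
  calc _ ≤ ε / 2 * √N * ‖c‖ + ε / 2 * √N * ‖c‖ := by
        refine (norm_add_le _ _).trans (add_le_add ((norm_orbitSum_le c _).trans ?_) (hN c))
        gcongr
    _ = ε * √N * ‖c‖ := by ring

theorem eventually_orbitGramEigenvalue_div_lt (D : SpectralDecomposition V g) {i : ℕ} {y : ℝ}
    (hy : ‖D.a i‖ ^ 2 < y) : ∀ᶠ N : ℕ in atTop, orbitGramEigenvalue V g N i / N < y := by
  obtain ⟨ξ, hinj, hξ⟩ := D.exists_injective_eigenvalue
  obtain ⟨ε, hεy, hε⟩ : ∃ ε, (‖D.a i‖ * (1 + ε) + ε) ^ 2 < y ∧ 0 < ε := by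
    have hcont : Tendsto (fun ε : ℝ => (‖D.a i‖ * (1 + ε) + ε) ^ 2) (𝓝[>] 0)
        (𝓝 (‖D.a i‖ ^ 2)) :=
      (Continuous.tendsto' (by fun_prop) _ _ (by simp)).mono_left nhdsWithin_le_nhds
    exact ((hcont.eventually_lt_const hy).and self_mem_nhdsWithin).exists
  obtain ⟨t, ht⟩ := D.exists_finset_eventually_norm_orbitSum_sub_le hε
  rw [← Finset.sum_coe_sort t] at ht
  let head : Finset t := Finset.univ.filter fun j => (j : ℕ) < i
  have hhead : head.card ≤ i := by
    simpa using Finset.card_le_card_of_injOn (t := Finset.range i) (fun j : t => (j : ℕ))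
      (by simp [head, Set.MapsTo])
      (fun j _ k _ h => Subtype.ext (Subtype.ext h))
  filter_upwards [eventually_orbitGramEigenvalue_le
    (D.orthonormal.comp _ (Subtype.val_injective (p := (· ∈ t)))) (fun j => hξ j)
    (hinj.comp Subtype.val_injective) (norm_nonneg (D.a i))
    (b := fun j => D.a j) (s := head) (fun j hj => D.coeff_antitone (by simpa [head] using hj))
    hε ht hhead, eventually_gt_atTop 0] with N hN hN0
  rw [Function.comp_def, add_sub_cancel] at hN
  exact ((div_le_iff₀ (Nat.cast_pos.2 hN0)).2 hN).trans_lt hεy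

theorem tendsto_orbitGramEigenvalue_div (D : SpectralDecomposition V g) (i : ℕ) :
    Tendsto (fun N : ℕ => orbitGramEigenvalue V g N i / N) atTop (𝓝 (‖D.a i‖ ^ 2)) :=
  tendsto_order.2 ⟨fun _ => D.eventually_lt_orbitGramEigenvalue_div,
    fun _ => D.eventually_orbitGramEigenvalue_div_lt⟩

end SpectralDecomposition

/-! ### Time series -/

theorem SpectralDecomposition.tendsto_orbitGramEigenvalue_succ_div {E : Type*}
    [NormedAddCommGroup E] [InnerProductSpace ℂ E] [CompleteSpace E] {V : E →ₗᵢ[ℂ] E} {g : E}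
    (D : SpectralDecomposition V g) (i : ℕ) :
    Tendsto (fun N : ℕ => orbitGramEigenvalue V g (N + 1) i / N) atTop (𝓝 (‖D.a i‖ ^ 2)) := by
  have hratio : Tendsto (fun N : ℕ => ((N + 1 : ℕ) : ℝ) / N) atTop (𝓝 1) := by
    simpa using (tendsto_natCast_div_add_atTop (1 : ℝ)).inv₀ one_ne_zero
  have hlim := ((tendsto_add_atTop_iff_nat 1).2 (D.tendsto_orbitGramEigenvalue_div i)).mul hratio
  rw [mul_one] at hlim
  exact hlim.congr fun N => div_mul_div_cancel₀ (Nat.cast_ne_zero.2 N.succ_ne_zero)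

/-- A vector is cyclic for `V` if its forward orbit spans a dense subspace. -/
def IsCyclicVector {E : Type*} [NormedAddCommGroup E] [InnerProductSpace ℂ E] (V : E →ₗᵢ[ℂ] E)
    (g : E) : Prop :=
  Dense (Submodule.span ℂ (Set.range fun l : ℕ => (V ^ l) g) : Set E)

variable {f : ℕ → ℂ} {hf : HasAutocovariances f}

/-- The shifted series `F_l` as an element of the span of the shifts. -/
def preShifted (f : ℕ → ℂ) (hf : HasAutocovariances f) (l : ℕ) : PreSpace f hf :=
  ⟨fun k => f (k + l), Submodule.subset_span ⟨l, rfl⟩⟩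

theorem timeShift_pow_obs (l : ℕ) :
    (timeShift f hf ^ l) (obs f hf) = (preShifted f hf l : HSpace f hf) := by
  induction l with
  | zero => rfl
  | succ l ih =>
    have hshift : preShift f hf (preShifted f hf l) = preShifted f hf (l + 1) :=
      Subtype.ext (funext fun k => congrArg f (by ring))
    rw [pow_succ', ← hshift]
    exact (congrArg (timeShift f hf) ih).trans (ContinuousLinearMap.completion_apply_coe _ _)

theorem isCyclicVector_obs : IsCyclicVector (timeShift f hf) (obs f hf) := by
  have hspan : Submodule.span ℂ (Set.range (preShifted f hf)) = ⊤ := by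
    refine Eq.trans (congrArg _ ?_) (Submodule.span_span_coe_preimage
      (s := Set.range fun l k : ℕ => f (k + l)))
    exact Set.ext fun x => exists_congr fun l => Subtype.ext_iff
  refine (UniformSpace.Completion.denseRange_coe (α := PreSpace f hf)).mono ?_
  rintro _ ⟨x, rfl⟩
  have hx := Submodule.mem_map_of_mem
    (f := (UniformSpace.Completion.toComplₗᵢ (𝕜 := ℂ) (E := PreSpace f hf)).toLinearMap)
    (hspan ▸ Submodule.mem_top (x := x))
  rw [Submodule.map_span, ← Set.range_comp] at hx
  simp only [timeShift_pow_obs]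
  exact hx

theorem tendsto_gramMatrix (N : ℕ) :
    Tendsto (gramMatrix f N) atTop (𝓝 (orbitGram (timeShift f hf) (obs f hf) (N + 1))) := by
  refine tendsto_pi_nhds.2 fun i => tendsto_pi_nhds.2 fun j => ?_
  have hinner : orbitGram (timeShift f hf) (obs f hf) (N + 1) i j =
      avgInner (preShifted f hf i) (preShifted f hf j) := by
    rw [orbitGram, Matrix.of_apply, timeShift_pow_obs, timeShift_pow_obs,
      UniformSpace.Completion.inner_coe]
    rfl
  have hratio : Tendsto (fun M : ℕ => ((M + 1 : ℕ) : ℂ) / M) atTop (𝓝 1) := by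
    simpa using (tendsto_natCast_div_add_atTop (1 : ℂ)).inv₀ one_ne_zero
  have hlim := ((tendsto_add_atTop_iff_nat 1).2
    (avgInner_spec (preShifted f hf i) (preShifted f hf j))).mul hratio
  rw [mul_one, ← hinner] at hlim
  refine hlim.congr fun M => ?_
  have hM : ((M + 1 : ℕ) : ℂ) ≠ 0 := Nat.cast_ne_zero.2 M.succ_ne_zero
  simp only [timeAverage, gramMatrix, Matrix.of_apply, PreSpace.seq, preShifted,
    add_comm (i : ℕ), add_comm (j : ℕ)]
  field_simp

theorem tendsto_gramEigenvalue (hf : HasAutocovariances f) (N i : ℕ) :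
    Tendsto (fun M => gramEigenvalue f N M i) atTop
      (𝓝 (orbitGramEigenvalue (timeShift f hf) (obs f hf) (N + 1) i)) := by
  unfold gramEigenvalue orbitGramEigenvalue
  split_ifs with h
  · exact tendsto_eigenvalues₀ _ _ (tendsto_gramMatrix N) _
  · exact tendsto_const_nhds

/-! ### The spectral theorem -/

section Multiplication

variable {X : Type*} [TopologicalSpace X] [CompactSpace X] [MeasurableSpace X] [BorelSpace X]

theorem norm_toLp_sq (ν : Measure X) [IsFiniteMeasure ν] (φ : C(X, ℂ)) :
    ‖ContinuousMap.toLp 2 ν ℂ φ‖ ^ 2 = ∫ x, ‖φ x‖ ^ 2 ∂ν := by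
  refine Complex.ofReal_injective ?_
  rw [Complex.ofReal_pow, ← integral_complex_ofReal]
  refine (inner_self_eq_norm_sq_to_K (𝕜 := ℂ) (ContinuousMap.toLp 2 ν ℂ φ)).symm.trans ?_
  simp only [ContinuousMap.inner_toLp, Complex.mul_conj', Complex.ofReal_pow]

/-- Multiplication by a continuous function on `L²`. -/
def mulL2 (ν : Measure X) [IsFiniteMeasure ν] (φ : C(X, ℂ)) : Lp ℂ 2 ν →L[ℂ] Lp ℂ 2 ν :=
  (ContinuousLinearMap.mul ℂ ℂ).holderL ν ⊤ 2 2 (ContinuousMap.toLp ⊤ ν ℂ φ)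

theorem coeFn_mulL2 {ν : Measure X} [IsFiniteMeasure ν] (φ : C(X, ℂ)) (ψ : Lp ℂ 2 ν) :
    mulL2 ν φ ψ =ᵐ[ν] fun x => φ x * ψ x := by
  have hholder : mulL2 ν φ ψ =ᵐ[ν] fun x =>
      (ContinuousLinearMap.mul ℂ ℂ) (ContinuousMap.toLp ⊤ ν ℂ φ x) (ψ x) :=
    ContinuousLinearMap.coeFn_holder _ _ _
  filter_upwards [hholder, ContinuousMap.coeFn_toLp (p := ⊤) (𝕜 := ℂ) ν φ] with x hx hφ
  rw [hx, hφ, ContinuousLinearMap.mul_apply']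

theorem mulL2_toLp (ν : Measure X) [IsFiniteMeasure ν] (φ ψ : C(X, ℂ)) :
    mulL2 ν φ (ContinuousMap.toLp 2 ν ℂ ψ) = ContinuousMap.toLp 2 ν ℂ (φ * ψ) := by
  apply Lp.ext
  filter_upwards [coeFn_mulL2 φ (ContinuousMap.toLp 2 ν ℂ ψ),
    ContinuousMap.coeFn_toLp (p := 2) (𝕜 := ℂ) ν ψ,
    ContinuousMap.coeFn_toLp (p := 2) (𝕜 := ℂ) ν (φ * ψ)] with x hmul hψ hφψ
  rw [hmul, hψ, hφψ, ContinuousMap.mul_apply]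

end Multiplication

section CyclicRepresentation

variable {X : Type*} [TopologicalSpace X]
  {H : Type*} [NormedAddCommGroup H] [InnerProductSpace ℂ H] [CompleteSpace H]
  (Φ : C(X, ℂ) →⋆ₐ[ℂ] (H →L[ℂ] H)) (g : H)

theorem inner_map_star_mul_self (φ : C(X, ℂ)) :
    inner ℂ g (Φ (star φ * φ) g) = (‖Φ φ g‖ : ℂ) ^ 2 := by
  rw [map_mul, map_star, mul_apply_eq_comp, ContinuousLinearMap.star_eq_adjoint,
    ContinuousLinearMap.adjoint_inner_right, inner_self_eq_norm_sq_to_K]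
  rfl

variable [CompactSpace X] [T2Space X] [MeasurableSpace X] [BorelSpace X]

theorem exists_regular_norm_sq_eq_integral :
    ∃ ν : Measure X, IsFiniteMeasure ν ∧ ν.Regular ∧
      ∀ φ : C(X, ℂ), ‖Φ φ g‖ ^ 2 = ∫ x, ‖φ x‖ ^ 2 ∂ν := by
  let ofReal : C(X, ℝ) →L[ℝ] C(X, ℂ) := Complex.ofRealCLM.compLeftContinuous ℝ X
  let vectorState : CompactlySupportedContinuousMap X ℝ →ₗ[ℝ] ℝ :=
    { toFun := fun φ => (inner ℂ g (Φ (ofReal φ.toContinuousMap) g)).re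
      map_add' := fun φ ψ => by
        rw [← Complex.add_re, ← inner_add_right, ← add_apply, ← map_add, ← map_add]
        rfl
      map_smul' := fun c φ => by
        have hsmul : ofReal (c • φ).toContinuousMap = (c : ℂ) • ofReal φ.toContinuousMap := by
          ext x
          simp [ofReal]
        rw [hsmul, map_smul, smul_apply, inner_smul_right,
          Complex.re_ofReal_mul]
        rfl }
  have hstate (φ : CompactlySupportedContinuousMap X ℝ) (ψ : C(X, ℂ))
      (h : ∀ x, φ x = ‖ψ x‖ ^ 2) : vectorState φ = ‖Φ ψ g‖ ^ 2 := by
    have hφ : ofReal φ.toContinuousMap = star ψ * ψ := by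
      ext x
      simpa [ofReal, Complex.conj_mul'] using congrArg Complex.ofReal (h x)
    change (inner ℂ g (Φ (ofReal φ.toContinuousMap) g)).re = _
    rw [hφ, inner_map_star_mul_self, ← Complex.ofReal_pow, Complex.ofReal_re]
  have hpos (φ : CompactlySupportedContinuousMap X ℝ) (hφ : 0 ≤ φ) : 0 ≤ vectorState φ := by
    rw [hstate φ (ofReal ⟨fun x => √(φ x), by fun_prop⟩) fun x => by
      simp [ofReal, Real.sq_sqrt (hφ x)]]
    positivity
  let Λ := PositiveLinearMap.mk₀ vectorState hpos
  refine ⟨RealRMK.rieszMeasure Λ, inferInstance, inferInstance, fun φ => ?_⟩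
  let φsq := CompactlySupportedContinuousMap.continuousMapEquiv
    (⟨fun x => ‖φ x‖ ^ 2, by fun_prop⟩ : C(X, ℝ))
  rw [← hstate φsq φ fun x => rfl]
  exact (RealRMK.integral_rieszMeasure Λ φsq).symm

theorem exists_linearIsometry_toLp_eq : ∃ (ν : Measure X) (_ : IsFiniteMeasure ν)
    (W : Lp ℂ 2 ν →ₗᵢ[ℂ] H), W (ContinuousMap.toLp 2 ν ℂ 1) = g ∧
      ∀ φ ψ, Φ φ (W ψ) = W (mulL2 ν φ ψ) := by
  obtain ⟨ν, hfin, hreg, hnorm⟩ := exists_regular_norm_sq_eq_integral Φ g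
  let evalAt : C(X, ℂ) →ₗ[ℂ] H := (ContinuousLinearMap.apply ℂ H g).toLinearMap ∘ₗ Φ.toLinearMap
  let toL2 : C(X, ℂ) →ₗ[ℂ] Lp ℂ 2 ν := (ContinuousMap.toLp 2 ν ℂ).toLinearMap
  have hdense : DenseRange toL2 := ContinuousMap.toLp_denseRange ℂ ν ℂ ENNReal.ofNat_ne_top
  have hisom (φ : C(X, ℂ)) : ‖evalAt φ‖ = ‖toL2 φ‖ :=
    (sq_eq_sq₀ (norm_nonneg _) (norm_nonneg _)).1 ((hnorm φ).trans (norm_toLp_sq ν φ).symm)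
  have hext (φ : C(X, ℂ)) : evalAt.extendOfNorm toL2 (toL2 φ) = Φ φ g :=
    LinearMap.extendOfNorm_eq hdense ⟨1, fun φ => by rw [one_mul, hisom]⟩ φ
  let W : Lp ℂ 2 ν →ₗᵢ[ℂ] H := ⟨(evalAt.extendOfNorm toL2).toLinearMap, fun ψ =>
    hdense.induction_on (p := fun ψ => ‖evalAt.extendOfNorm toL2 ψ‖ = ‖ψ‖) ψ
      (isClosed_eq (by fun_prop) continuous_norm) fun φ => by rw [hext, ← hisom]; rfl⟩
  have hW (φ : C(X, ℂ)) : W (ContinuousMap.toLp 2 ν ℂ φ) = Φ φ g := hext φ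
  refine ⟨ν, hfin, W, by rw [hW, map_one, one_apply_eq_self], fun φ ψ => ?_⟩
  refine hdense.induction_on (p := fun ψ => Φ φ (W ψ) = W (mulL2 ν φ ψ)) ψ
    (isClosed_eq ((Φ φ).continuous.comp W.continuous)
      (W.continuous.comp (mulL2 ν φ).continuous)) fun χ => ?_
  change Φ φ (W (ContinuousMap.toLp 2 ν ℂ χ)) = W (mulL2 ν φ (ContinuousMap.toLp 2 ν ℂ χ))
  rw [mulL2_toLp, hW, hW, map_mul, mul_apply_eq_comp]

end CyclicRepresentation

section Indicators

variable {X : Type*} [MeasurableSpace X]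

/-- The indicator function of a measurable set as a vector of `L²` of a finite measure. -/
abbrev indicatorL2 (ν : Measure X) [IsFiniteMeasure ν] {B : Set X} (hB : MeasurableSet B) :
    Lp ℂ 2 ν :=
  indicatorConstLp 2 hB (measure_ne_top ν B) 1

theorem indicatorL2_mem_closure_span [MeasurableSingletonClass X] (ν : Measure X)
    [IsFiniteMeasure ν] {A : Set X} (hA : A.Countable) :
    indicatorL2 ν hA.measurableSet ∈ (Submodule.span ℂ
      (Set.range fun x => indicatorL2 ν (measurableSet_singleton x))).topologicalClosure := by
  rw [← Submodule.orthogonal_orthogonal_eq_closure, Submodule.mem_orthogonal']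
  intro f hf
  have hatom (x : X) : ν.real {x} • f x = 0 := by
    rw [← integral_singleton, ← L2.inner_indicatorConstLp_one (measurableSet_singleton x)
      (measure_ne_top ν {x})]
    exact hf _ (Submodule.subset_span ⟨x, rfl⟩)
  rw [L2.inner_indicatorConstLp_one, setIntegral_countable _ hA
    ((Lp.memLp f).integrable one_le_two).integrableOn]
  simp only [hatom, tsum_zero]

variable [TopologicalSpace X] [CompactSpace X] [BorelSpace X] (ν : Measure X) [IsFiniteMeasure ν]

theorem toLp_one_eq_indicatorL2_univ :
    ContinuousMap.toLp 2 ν ℂ 1 = indicatorL2 ν MeasurableSet.univ := by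
  apply Lp.ext
  filter_upwards [ContinuousMap.coeFn_toLp (p := 2) (𝕜 := ℂ) ν (1 : C(X, ℂ)),
    indicatorConstLp_coeFn_mem (p := 2) (hs := MeasurableSet.univ) (hμs := measure_ne_top ν _)
      (c := (1 : ℂ))] with x hone hind
  rw [hone, hind trivial, ContinuousMap.one_apply]

theorem inner_indicatorL2_mulL2 {B : Set X} (hB : MeasurableSet B) (φ : C(X, ℂ)) :
    inner ℂ (indicatorL2 ν hB) (mulL2 ν φ (indicatorL2 ν hB)) = ∫ x in B, φ x ∂ν := by
  rw [L2.inner_indicatorConstLp_one]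
  refine setIntegral_congr_ae hB ?_
  filter_upwards [coeFn_mulL2 φ (indicatorL2 ν hB), indicatorConstLp_coeFn_mem (p := 2) (hs := hB)
    (hμs := measure_ne_top ν B) (c := (1 : ℂ))] with x hmul hind hx
  rw [hmul, hind hx, mul_one]

theorem mulL2_indicatorL2_singleton [MeasurableSingletonClass X] (φ : C(X, ℂ)) (x : X) :
    mulL2 ν φ (indicatorL2 ν (measurableSet_singleton x)) =
      φ x • indicatorL2 ν (measurableSet_singleton x) := by
  apply Lp.ext
  filter_upwards [coeFn_mulL2 φ (indicatorL2 ν (measurableSet_singleton x)),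
    Lp.coeFn_smul (φ x) (indicatorL2 ν (measurableSet_singleton x)),
    indicatorConstLp_coeFn_notMem (p := 2) (hs := measurableSet_singleton x)
      (hμs := measure_ne_top ν _) (c := (1 : ℂ))] with y hmul hsmul hind
  rw [hmul, hsmul, Pi.smul_apply, smul_eq_mul]
  rcases eq_or_ne y x with rfl | hy
  · rfl
  · rw [hind hy, mul_zero, mul_zero]

end Indicators

theorem exists_atomic_singular_absolutelyContinuous_partition {X : Type*} [MeasurableSpace X]
    [MeasurableSingletonClass X] (ν μ : Measure X) [SFinite ν] [ν.HaveLebesgueDecomposition μ] :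
    ∃ A B C : Set X, A.Countable ∧ MeasurableSet B ∧ MeasurableSet C ∧ Disjoint A B ∧
      Disjoint (A ∪ B) C ∧ A ∪ B ∪ C = Set.univ ∧
      (∀ x, ν.restrict B {x} = 0) ∧ ν.restrict B ⟂ₘ μ ∧ ν.restrict C ≪ μ := by
  let A : Set X := {x | 0 < ν {x}}
  have hA : A.Countable := Measure.countable_meas_pos_of_disjoint_iUnion
    (fun x => measurableSet_singleton x) fun x y h => by simpa using h
  obtain ⟨S, hS, hνS, hμS⟩ := ν.mutuallySingular_singularPart μ
  have hac : ν.restrict S ≪ μ := by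
    rw [ν.haveLebesgueDecomposition_add μ, Measure.restrict_add,
      Measure.restrict_eq_zero.2 hνS, zero_add]
    exact Measure.restrict_le_self.absolutelyContinuous.trans
      (withDensity_absolutelyContinuous _ _)
  refine ⟨A, Sᶜ \ A, S \ A, hA, hS.compl.diff hA.measurableSet, hS.diff hA.measurableSet,
    Set.disjoint_sdiff_right, ?_, ?_, fun x => ?_, ⟨S, hS, ?_, hμS⟩,
    (Measure.restrict_mono_set ν Set.sdiff_subset).absolutelyContinuous.trans hac⟩
  · exact Set.disjoint_union_left.2 ⟨Set.disjoint_sdiff_right,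
      disjoint_compl_left.mono Set.sdiff_subset Set.sdiff_subset⟩
  · ext x
    simp only [Set.mem_union, Set.mem_sdiff, Set.mem_compl_iff, Set.mem_univ, iff_true]
    tauto
  · rw [Measure.restrict_apply (measurableSet_singleton x)]
    by_cases hx : x ∈ A
    · rw [Set.singleton_inter_eq_empty.2 fun h => h.2 hx, measure_empty]
    · exact measure_mono_null Set.inter_subset_left (nonpos_iff_eq_zero.1 (not_lt.1 hx))
  · rw [Measure.restrict_apply hS,
      (disjoint_compl_right.mono_right Set.sdiff_subset).inter_eq, measure_empty]

instance : IsFiniteMeasure arcLength := by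
  have : IsFiniteMeasure (volume.restrict (Set.Ioc (-Real.pi) Real.pi)) :=
    ⟨by simp [Real.volume_Ioc]⟩
  exact Measure.isFiniteMeasure_map _ _

section Unitary

variable {H : Type*} [NormedAddCommGroup H] [InnerProductSpace ℂ H]

/-- The inclusion of the circle into the complex plane. -/
def circleCoe : C(Circle, ℂ) := ⟨fun z => (z : ℂ), by fun_prop⟩

theorem exists_circle_functionalCalculus [CompleteSpace H] {u : H →L[ℂ] H}
    (hu : u ∈ unitary (H →L[ℂ] H)) :
    ∃ Φ : C(Circle, ℂ) →⋆ₐ[ℂ] (H →L[ℂ] H), Φ circleCoe = u := by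
  have hn : IsStarNormal u := Unitary.coe_isStarNormal ⟨u, hu⟩
  let incl : C(spectrum ℂ u, Circle) :=
    ⟨fun z => ⟨z, spectrum.subset_circle_of_unitary hu z.2⟩, by fun_prop⟩
  exact ⟨(cfcHom hn).comp (ContinuousMap.compStarAlgHom' ℂ ℂ incl), cfcHom_id hn⟩

theorem exists_spectralRepresentation [CompleteSpace H] (U : H ≃ₗᵢ[ℂ] H) (g : H) :
    ∃ (ν : Measure Circle) (_ : IsFiniteMeasure ν) (W : Lp ℂ 2 ν →ₗᵢ[ℂ] H),
      W (ContinuousMap.toLp 2 ν ℂ 1) = g ∧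
        ∀ k ψ, (U.toLinearIsometry ^ k) (W ψ) = W (mulL2 ν (circleCoe ^ k) ψ) := by
  let u : unitary (H →L[ℂ] H) := Unitary.linearIsometryEquiv.symm U
  have hpow (k : ℕ) (x : H) : (U.toLinearIsometry ^ k) x = ((u : H →L[ℂ] H) ^ k) x := by
    rw [LinearIsometry.coe_pow, FunLike.coe_pow_eq_iterate]
    rfl
  obtain ⟨Φ, hΦ⟩ := exists_circle_functionalCalculus u.2
  obtain ⟨ν, hν, W, hone, hW⟩ := exists_linearIsometry_toLp_eq Φ g
  exact ⟨ν, hν, W, hone, fun k ψ => by rw [hpow, ← hΦ, ← map_pow, hW]⟩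

theorem exists_spectral_splitting [CompleteSpace H] (U : H ≃ₗᵢ[ℂ] H) (g : H) :
    ∃ gpp gsc gac : H, g = gpp + gsc + gac ∧
      gpp ∈ (Submodule.span ℂ {w : H | ∃ ξ : ℂ, U w = ξ • w}).topologicalClosure ∧
      (∃ ν, IsSpectralMeasure U.toLinearIsometry gsc ν ∧ (∀ z, ν {z} = 0) ∧ ν ⟂ₘ arcLength) ∧
      ∃ ν, IsSpectralMeasure U.toLinearIsometry gac ν ∧ ν ≪ arcLength := by
  obtain ⟨ν, hν, W, hone, hW⟩ := exists_spectralRepresentation U g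
  obtain ⟨A, B, C, hA, hB, hC, hAB, hABC, hunion, hatom, hsing, hac⟩ :=
    exists_atomic_singular_absolutelyContinuous_partition ν arcLength
  have hspec {D : Set Circle} (hD : MeasurableSet D) :
      IsSpectralMeasure U.toLinearIsometry (W (indicatorL2 ν hD)) (ν.restrict D) :=
    ⟨inferInstance, fun k => by
      rw [hW, W.inner_map_map, inner_indicatorL2_mulL2]
      rfl⟩
  have hdecomp : indicatorL2 ν MeasurableSet.univ =
      indicatorL2 ν hA.measurableSet + indicatorL2 ν hB + indicatorL2 ν hC := by
    simp only [indicatorL2]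
    rw [← indicatorConstLp_disjoint_union _ _ _ _ hAB,
      ← indicatorConstLp_disjoint_union _ _ _ _ hABC]
    simp only [hunion]
  refine ⟨W (indicatorL2 ν hA.measurableSet), W (indicatorL2 ν hB), W (indicatorL2 ν hC), ?_,
    ?_, ⟨_, hspec hB, hatom, hsing⟩, _, hspec hC, hac⟩
  · rw [← map_add, ← map_add, ← hdecomp, ← toLp_one_eq_indicatorL2_univ, hone]
  · refine map_mem_closure W.continuous (indicatorL2_mem_closure_span ν hA) fun ψ hψ => ?_
    refine (Submodule.span_le (p := (Submodule.span ℂ _).comap W.toLinearMap)).2 ?_ hψ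
    rintro _ ⟨z, rfl⟩
    refine Submodule.subset_span ⟨z, ?_⟩
    have hz := hW 1 (indicatorL2 ν (measurableSet_singleton z))
    rw [pow_one, pow_one, mulL2_indicatorL2_singleton, map_smul] at hz
    exact hz

end Unitary

/-! ### The unitary part -/

section UnitaryPart

variable {E : Type*} [NormedAddCommGroup E] [InnerProductSpace ℂ E] {V : E →ₗᵢ[ℂ] E}

theorem apply_pow_apply (V : E →ₗᵢ[ℂ] E) (k : ℕ) (x : E) : V ((V ^ k) x) = (V ^ (k + 1)) x := by
  rw [add_comm, pow_add_apply, pow_one]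

theorem mem_unitaryPart_iff {x : E} : x ∈ unitaryPart V ↔ ∀ k : ℕ, ∃ y, (V ^ k) y = x := by
  simp only [unitaryPart, Submodule.mem_iInf]
  rfl

theorem apply_mem_unitaryPart {x : E} (hx : x ∈ unitaryPart V) : V x ∈ unitaryPart V := by
  rw [mem_unitaryPart_iff] at hx ⊢
  intro k
  obtain ⟨y, rfl⟩ := hx k
  exact ⟨V y, by rw [apply_pow_apply, pow_add_apply, pow_one]⟩

theorem exists_apply_eq_of_mem_unitaryPart {x : E} (hx : x ∈ unitaryPart V) :
    ∃ y ∈ unitaryPart V, V y = x := by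
  rw [mem_unitaryPart_iff] at hx
  obtain ⟨y, hy⟩ := hx 1
  rw [pow_one] at hy
  refine ⟨y, mem_unitaryPart_iff.2 fun k => ?_, hy⟩
  obtain ⟨z, hz⟩ := hx (k + 1)
  exact ⟨z, V.injective (by rw [hy, ← hz, apply_pow_apply])⟩

theorem isClosed_unitaryPart [CompleteSpace E] (V : E →ₗᵢ[ℂ] E) :
    IsClosed (unitaryPart V : Set E) := by
  rw [unitaryPart, Submodule.coe_iInf]
  exact isClosed_iInter (isClosed_range_pow V)

/-- The unitary operator that an isometry induces on its unitary part. -/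
def unitaryPartEquiv (V : E →ₗᵢ[ℂ] E) : unitaryPart V ≃ₗᵢ[ℂ] unitaryPart V :=
  LinearIsometryEquiv.ofSurjective
    ⟨V.toLinearMap.restrict fun _ hx => apply_mem_unitaryPart hx, fun x => V.norm_map x⟩
    fun x => by
      obtain ⟨y, hy, hyx⟩ := exists_apply_eq_of_mem_unitaryPart x.2
      exact ⟨⟨y, hy⟩, Subtype.ext hyx⟩

theorem coe_unitaryPartEquiv_apply (x : unitaryPart V) : (unitaryPartEquiv V x : E) = V x := rfl

theorem coe_unitaryPartEquiv_pow (k : ℕ) (x : unitaryPart V) :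
    (((unitaryPartEquiv V).toLinearIsometry ^ k) x : E) = (V ^ k) x := by
  induction k with
  | zero => rfl
  | succ k ih => rw [← apply_pow_apply, ← apply_pow_apply, ← ih]; rfl

theorem isSpectralMeasure_of_unitaryPartEquiv {x : unitaryPart V} {ν : Measure Circle}
    (h : IsSpectralMeasure (unitaryPartEquiv V).toLinearIsometry x ν) :
    IsSpectralMeasure V x ν :=
  ⟨h.1, fun k => by rw [h.2, Submodule.coe_inner, coe_unitaryPartEquiv_pow]⟩

theorem exists_splitting [CompleteSpace E] (V : E →ₗᵢ[ℂ] E) (g : E) :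
    ∃ gpp gsc gac gnu : E, g = gpp + gsc + gac + gnu ∧
      gpp ∈ (Submodule.span ℂ {w : E | ∃ ξ : ℂ, V w = ξ • w}).topologicalClosure ∧
      gsc ∈ singularContinuousPart V ∧ gac ∈ absolutelyContinuousPart V ∧
      gnu ∈ nonUnitaryPart V := by
  have : CompleteSpace (unitaryPart V) := (isClosed_unitaryPart V).completeSpace_coe
  obtain ⟨gpp, gsc, gac, hsum, hpp, ⟨ν, hν, hatom, hsing⟩, ⟨μ, hμ, hac⟩⟩ :=
    exists_spectral_splitting (unitaryPartEquiv V) ((unitaryPart V).orthogonalProjectionOnto g)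
  refine ⟨gpp, gsc, gac, g - (unitaryPart V).orthogonalProjectionOnto g, ?_, ?_,
    ⟨gsc.2, ν, isSpectralMeasure_of_unitaryPartEquiv hν, hatom, hsing⟩,
    ⟨gac.2, μ, isSpectralMeasure_of_unitaryPartEquiv hμ, hac⟩,
    (unitaryPart V).sub_starProjection_mem_orthogonal g⟩
  · rw [hsum]
    push_cast
    abel
  · refine map_mem_closure continuous_subtype_val hpp fun x hx => ?_
    refine (Submodule.span_le
      (p := (Submodule.span ℂ {w : E | ∃ ξ : ℂ, V w = ξ • w}).comap
        (unitaryPart V).subtype)).2 ?_ hx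
    rintro w ⟨ξ, hw⟩
    exact Submodule.subset_span ⟨ξ, by
      rw [Submodule.subtype_apply, ← coe_unitaryPartEquiv_apply, hw, Submodule.coe_smul]⟩

end UnitaryPart

/-! ### Enumeration in nonincreasing order -/

section SortedEnumeration

theorem exists_orderIso_subtype_lt (S : Set ℕ) :
    ∃ n : ℕ∞, Nonempty ({k : ℕ // (k : ℕ∞) < n} ≃o S) := by
  rcases S.finite_or_infinite with hS | hS
  · lift S to Finset ℕ using hS
    have hlt (k : ℕ) : (k : ℕ∞) < (S.card : ℕ∞) ↔ k < S.card := Nat.cast_lt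
    exact ⟨S.card, ⟨(OrderIso.setCongr _ _ (Set.ext hlt)).trans
      (Fin.orderIsoSubtype.symm.trans (S.orderIsoOfFin rfl))⟩⟩
  · have := hS.to_subtype
    have htop : {k : ℕ | (k : ℕ∞) < ⊤} = Set.univ := Set.eq_univ_of_forall ENat.natCast_lt_top
    exact ⟨⊤, ⟨((OrderIso.setCongr _ _ htop).trans OrderIso.Set.univ).trans
      (Nat.Subtype.orderIsoOfNat S)⟩⟩

theorem exists_injective_rank {ι α : Type*} [LinearOrder α] (c : ι → α)
    (hc : ∀ i, {j | c i ≤ c j}.Finite) :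
    ∃ r : ι → ℕ, Function.Injective r ∧ ∀ i j, r i ≤ r j → c j ≤ c i := by
  obtain ⟨_, _⟩ := exists_wellFoundedLT (α := ι)
  let key (i : ι) : αᵒᵈ ×ₗ ι := toLex (OrderDual.toDual (c i), i)
  have hkey {i j : ι} (h : key i ≤ key j) : c j ≤ c i := Prod.Lex.monotone_fst _ _ h
  have hfin (i : ι) : {j | key j < key i}.Finite := (hc i).subset fun j hj => hkey hj.le
  let rank (i : ι) : ℕ := {j | key j < key i}.ncard
  have hrank {i j : ι} (h : key i < key j) : rank i < rank j :=
    Set.ncard_lt_ncard ⟨fun k hk => hk.trans h, fun hsub => lt_irrefl (key i) (hsub h)⟩ (hfin j)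
  have hle {i j : ι} (h : rank i ≤ rank j) : key i ≤ key j :=
    not_lt.1 fun hlt => (hrank hlt).not_ge h
  refine ⟨rank, fun i j h => ?_, fun i j h => hkey (hle h)⟩
  exact congrArg (fun p => (ofLex p).2) (le_antisymm (hle h.le) (hle h.ge))

theorem exists_sorted_enumeration {ι α : Type*} [LinearOrder α] (c : ι → α)
    (hc : ∀ i, {j | c i ≤ c j}.Finite) :
    ∃ (n : ℕ∞) (e : {k : ℕ // (k : ℕ∞) < n} ≃ ι), ∀ k l, k ≤ l → c (e l) ≤ c (e k) := by
  obtain ⟨r, hr_inj, hr⟩ := exists_injective_rank c hc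
  obtain ⟨n, ⟨iso⟩⟩ := exists_orderIso_subtype_lt (Set.range r)
  have hrank (k : {k : ℕ // (k : ℕ∞) < n}) :
      r ((Equiv.ofInjective r hr_inj).symm (iso k)) = iso k :=
    Equiv.apply_ofInjective_symm hr_inj _
  refine ⟨n, iso.toEquiv.trans (Equiv.ofInjective r hr_inj).symm, fun k l hkl => hr _ _ ?_⟩
  change r ((Equiv.ofInjective r hr_inj).symm (iso k)) ≤
    r ((Equiv.ofInjective r hr_inj).symm (iso l))
  rw [hrank, hrank]
  exact iso.monotone hkl

end SortedEnumeration

/-! ### Existence of the decomposition -/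

section Expansion

variable {𝕜 E ι : Type*} [RCLike 𝕜] [NormedAddCommGroup E] [InnerProductSpace 𝕜 E] {v : ι → E}

theorem hasSum_inner_smul_of_mem_closure [CompleteSpace E] (hv : Orthonormal 𝕜 v) {x : E}
    (hx : x ∈ (Submodule.span 𝕜 (Set.range v)).topologicalClosure) :
    HasSum (fun i => inner 𝕜 (v i) x • v i) x := by
  obtain ⟨φ, hφx⟩ : x ∈ LinearMap.range hv.orthogonalFamily.linearIsometry.toLinearMap := by
    rw [OrthogonalFamily.range_linearIsometry]
    simpa only [Submodule.span_range_eq_iSup, LinearIsometry.toSpanSingleton,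
      LinearMap.range_toSpanSingleton] using hx
  have hφ : HasSum (fun i => φ i • v i) x := hφx ▸ hv.orthogonalFamily.hasSum_linearIsometry φ
  simpa only [inner_eq_of_hasSum_smul hv hφ] using hφ

theorem finite_setOf_le_norm_inner (hv : Orthonormal 𝕜 v) (x : E) {ε : ℝ} (hε : 0 < ε) :
    {i | ε ≤ ‖inner 𝕜 (v i) x‖}.Finite := by
  have hlt : ∀ᶠ i in cofinite, ‖inner 𝕜 (v i) x‖ ^ 2 < ε ^ 2 :=
    (hv.inner_products_summable x).tendsto_cofinite_zero.eventually (gt_mem_nhds (by positivity))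
  refine (eventually_cofinite.1 hlt).subset fun i hi => ?_
  simp only [Set.mem_ofPred_eq, not_lt] at hi ⊢
  gcongr

theorem hasSum_inner_smul_extend {κ : Type*} {e : ι → κ} (he : Function.Injective e) {x y : E}
    (h : HasSum (fun i => inner 𝕜 (v i) x • v i) y) :
    HasSum (fun k => inner 𝕜 (Function.extend e v 0 k) x • Function.extend e v 0 k) y := by
  refine (he.hasSum_iff fun k hk => ?_).1 ?_
  · rw [Function.extend_apply' _ _ _ hk, Pi.zero_apply, smul_zero]
  · simpa only [Function.comp_def, he.extend_apply] using h

end Expansion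

section Eigenvectors

variable {E : Type*} [NormedAddCommGroup E] [InnerProductSpace ℂ E] {V : E →ₗᵢ[ℂ] E} {g : E}

theorem inner_eigenvectors_eq_zero {v w : E} {ξ η : ℂ} (hv : V v = ξ • v) (hw : V w = η • w)
    (hne : ξ ≠ η) : inner ℂ v w = 0 := by
  by_cases hv0 : v = 0
  · rw [hv0, inner_zero_left]
  have h := inner_eigenvector_pow hv hv0 1 w
  rw [pow_one, pow_one, hw, inner_smul_right] at h
  exact (mul_eq_mul_right_iff.1 h).resolve_left hne.symm

theorem IsCyclicVector.eigenvector_eq_zero (hg : IsCyclicVector V g) {w : E} {ξ : ℂ}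
    (hw : V w = ξ • w) (hwg : inner ℂ w g = 0) : w = 0 := by
  by_contra hw0
  have hspan : Submodule.span ℂ (Set.range fun l : ℕ => (V ^ l) g) ≤ (ℂ ∙ w)ᗮ := by
    rw [Submodule.span_le]
    rintro _ ⟨l, rfl⟩
    rw [SetLike.mem_coe, Submodule.mem_orthogonal_singleton_iff_inner_right,
      inner_eigenvector_pow hw hw0, hwg, mul_zero]
  exact hw0 (Dense.eq_zero_of_inner_left ℂ hg fun x hx =>
    Submodule.mem_orthogonal_singleton_iff_inner_right.1 (hspan hx))

theorem IsCyclicVector.eigenvector_eq_smul (hg : IsCyclicVector V g) {v w : E} {ξ : ℂ}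
    (hv : V v = ξ • v) (hv0 : v ≠ 0) (hw : V w = ξ • w) : ∃ c : ℂ, w = c • v := by
  have hgv : inner ℂ g v ≠ 0 := fun h => hv0 (hg.eigenvector_eq_zero hv (inner_eq_zero_symm.1 h))
  refine ⟨inner ℂ g w / inner ℂ g v,
    sub_eq_zero.1 (hg.eigenvector_eq_zero (ξ := ξ) ?_ (inner_eq_zero_symm.1 ?_))⟩
  · rw [map_sub, map_smul, hw, hv, smul_sub, smul_comm]
  · rw [inner_sub_right, inner_smul_right, div_mul_cancel₀ _ hgv, sub_self]

theorem exists_orthonormal_eigenvectors (V : E →ₗᵢ[ℂ] E) :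
    ∃ v : {ξ : ℂ // ∃ w : E, w ≠ 0 ∧ V w = ξ • w} → E,
      Orthonormal ℂ v ∧ ∀ ξ, V (v ξ) = (ξ : ℂ) • v ξ := by
  choose w hw0 hVw using fun ξ : {ξ : ℂ // ∃ w : E, w ≠ 0 ∧ V w = ξ • w} => ξ.2
  have hV (ξ) : V ((‖w ξ‖ : ℂ)⁻¹ • w ξ) = (ξ : ℂ) • (‖w ξ‖ : ℂ)⁻¹ • w ξ := by
    rw [map_smul, hVw, smul_comm]
  exact ⟨fun ξ => (‖w ξ‖ : ℂ)⁻¹ • w ξ, ⟨fun ξ => norm_smul_inv_norm (hw0 ξ), fun ξ η hne =>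
    inner_eigenvectors_eq_zero (hV ξ) (hV η) (Subtype.coe_ne_coe.2 hne)⟩, hV⟩

theorem IsCyclicVector.exists_sorted_eigenvectors (hg : IsCyclicVector V g) :
    ∃ (n : ℕ∞) (v : {k : ℕ // (k : ℕ∞) < n} → E), Orthonormal ℂ v ∧
      (∀ k, ∃ ξ : ℂ, V (v k) = ξ • v k) ∧
      (∀ w : E, w ≠ 0 → (∃ ξ : ℂ, V w = ξ • w) → ∃ k, ∃ c : ℂ, w = c • v k) ∧
      Antitone fun k => ‖inner ℂ (v k) g‖ := by
  obtain ⟨v, hv, hVv⟩ := exists_orthonormal_eigenvectors V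
  have hpos (ξ) : 0 < ‖inner ℂ (v ξ) g‖ :=
    norm_pos_iff.2 fun h => hv.ne_zero ξ (hg.eigenvector_eq_zero (hVv ξ) h)
  obtain ⟨n, e, he⟩ := exists_sorted_enumeration (fun ξ => ‖inner ℂ (v ξ) g‖)
    fun ξ => finite_setOf_le_norm_inner hv g (hpos ξ)
  refine ⟨n, v ∘ e, hv.comp e e.injective, fun k => ⟨e k, hVv _⟩, ?_, he⟩
  rintro w hw0 ⟨ξ, hw⟩
  let ξ' : {ξ : ℂ // ∃ w : E, w ≠ 0 ∧ V w = ξ • w} := ⟨ξ, w, hw0, hw⟩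
  refine ⟨e.symm ξ', ?_⟩
  rw [Function.comp_apply, e.apply_symm_apply]
  exact hg.eigenvector_eq_smul (hVv ξ') (hv.ne_zero ξ') hw

theorem hasSum_inner_smul_eigenvectors [CompleteSpace E] {ι : Type*} {v : ι → E}
    (hv : Orthonormal ℂ v) (hVv : ∀ i, ∃ ξ : ℂ, V (v i) = ξ • v i)
    (hcomplete : ∀ w : E, w ≠ 0 → (∃ ξ : ℂ, V w = ξ • w) → ∃ i, ∃ c : ℂ, w = c • v i)
    {x y : E} (hx : x ∈ (Submodule.span ℂ {w : E | ∃ ξ : ℂ, V w = ξ • w}).topologicalClosure)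
    (hy : IsNegligible V (y - x)) :
    HasSum (fun i => inner ℂ (v i) y • v i) x := by
  have hspan : Submodule.span ℂ {w : E | ∃ ξ : ℂ, V w = ξ • w} ≤
      Submodule.span ℂ (Set.range v) := by
    rw [Submodule.span_le]
    intro w hw
    by_cases hw0 : w = 0
    · exact hw0 ▸ zero_mem _
    obtain ⟨i, c, rfl⟩ := hcomplete w hw0 hw
    exact Submodule.smul_mem _ _ (Submodule.subset_span (Set.mem_range_self i))
  refine (hasSum_inner_smul_of_mem_closure hv
    (Submodule.topologicalClosure_mono hspan hx)).congr_fun fun i => ?_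
  obtain ⟨ξ, hξ⟩ := hVv i
  rw [← sub_eq_zero, ← sub_smul, ← inner_sub_right, hy.inner_eigenvector hξ, zero_smul]

end Eigenvectors

theorem nonempty_spectralDecomposition {E : Type*} [NormedAddCommGroup E] [InnerProductSpace ℂ E]
    [CompleteSpace E] {V : E →ₗᵢ[ℂ] E} {g : E} (hg : IsCyclicVector V g) :
    Nonempty (SpectralDecomposition V g) := by
  obtain ⟨n, v, hv, hVv, hcomplete, hanti⟩ := hg.exists_sorted_eigenvectors
  obtain ⟨gpp, gsc, gac, gnu, hsplit, hpp, hsc, hac, hnu⟩ := exists_splitting V g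
  have hneg : IsNegligible V (g - gpp) := by
    rw [hsplit, add_assoc, add_assoc, add_sub_cancel_left]
    exact (isNegligible_of_mem_singularContinuousPart hsc).add
      ((isNegligible_of_mem_absolutelyContinuousPart hac).add
        (isNegligible_of_mem_nonUnitaryPart hnu))
  have hgpp : g - gsc - gac - gnu = gpp := by
    rw [hsplit]
    abel
  let u : ℕ → E := Function.extend Subtype.val v 0
  have hu (k : {k : ℕ // (k : ℕ∞) < n}) : u k = v k := Subtype.val_injective.extend_apply v 0 k
  have hu_zero {k : ℕ} (hk : n ≤ (k : ℕ∞)) : u k = 0 :=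
    Function.extend_apply' _ _ _ (by rintro ⟨j, rfl⟩; exact hk.not_gt j.2)
  exact ⟨{
    n := n
    v := u
    a := fun k => inner ℂ (u k) g
    gsc := gsc
    gac := gac
    gnu := gnu
    orthonormal := by simpa only [hu] using hv
    eigenvector := fun k hk => hu ⟨k, hk⟩ ▸ hVv ⟨k, hk⟩
    complete := fun w hw0 hw => by
      obtain ⟨k, c, hwk⟩ := hcomplete w hw0 hw
      exact ⟨k, k.2, c, hu k ▸ hwk⟩
    coeff_eq_zero := fun k hk => by rw [hu_zero hk, inner_zero_left]
    coeff_antitone := fun j k hjk => by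
      rcases lt_or_ge (k : ℕ∞) n with hk | hk
      · have hj : (j : ℕ∞) < n := (Nat.cast_le.2 hjk).trans_lt hk
        simpa only [hu ⟨j, hj⟩, hu ⟨k, hk⟩] using hanti (a := ⟨j, hj⟩) (b := ⟨k, hk⟩) hjk
      · simp only [hu_zero hk, inner_zero_left, norm_zero, norm_nonneg]
    gsc_mem := hsc
    gac_mem := hac
    gnu_mem := hnu
    hasSum := hgpp ▸ hasSum_inner_smul_extend Subtype.val_injective
      (hasSum_inner_smul_eigenvectors hv hVv hcomplete hpp hneg) }⟩

end TimeShift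

end

theorem mainTheorem2 (f : ℕ → ℂ) (hf : TimeShift.HasAutocovariances f) :
    Nonempty (TimeShift.SpectralDecomposition (TimeShift.timeShift f hf) (TimeShift.obs f hf)) ∧
    ∀ D : TimeShift.SpectralDecomposition (TimeShift.timeShift f hf) (TimeShift.obs f hf),
      ∀ i : ℕ, ∃ L : ℕ → ℝ,
        (∀ N : ℕ, Tendsto (fun M : ℕ => TimeShift.gramEigenvalue f N M i / (N : ℝ))
          atTop (𝓝 (L N))) ∧
        Tendsto L atTop (𝓝 (‖D.a i‖ ^ 2)) :=
  ⟨TimeShift.nonempty_spectralDecomposition TimeShift.isCyclicVector_obs, fun D i =>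
    ⟨fun N => TimeShift.orbitGramEigenvalue (TimeShift.timeShift f hf) (TimeShift.obs f hf)
        (N + 1) i / N,
      fun N => (TimeShift.tendsto_gramEigenvalue hf N i).div_const _,
      D.tendsto_orbitGramEigenvalue_succ_div i⟩⟩
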